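/- Let $R=k[x_1,\dots,x_n]$ be a polynomial ring over a field $k$, let $I\subsetneq R$ be a proper ideal (not necessarily homogeneous), and let $>_1$ be a term order on $R$. For an ideal $J$ and a term order $>$, $\mathrm{in}_>(J)$ denotes the ideal generated by the leading terms of the elements of $J$; for a monomial ideal $J$ and a variable $x$, $d_x(J)$ denotes the largest exponent of $x$ in a minimal monomial generator of $J$. Let $q\ge 0$, $t_1,\dots,t_q\ge 0$, and let $\{b_{i,j}\mid 1\le i\le q,\ 0\le j\le t_i\}$ be pairwise distinct variables of $R$ such that (1) $d_{b_{i,j}}(\mathrm{in}_{>_1}(I))\le 1$ for all $1\le i\le q$ and $1\le j\le t_i$; and (2) for each $1\le i\le q$, every minimal monomial generator of $\mathrm{in}_{>_1}(I)$ that is divisible by $b_{i,0}$ is divisible by $b_{i,j}$ for some $1\le j\le t_i$. Put $f_i=\sum_{j=0}^{t_i} b_{i,j}$ for $1\le i\le q$. Then, for all term orders $>_2,\dots,>_q$ on $R$ such that $b_{i,0}>_{i+1}b_{i,j}$ for all $1\le i\le q-1$ and $1\le j\le t_i$, the sequence $f_1,\dots,f_q$ is an initially regular sequence on $R/I$ with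 respect to $>_1,\dots,>_q$; that is, with $I_1=\mathrm{in}_{>_1}(I)$ and $I_i=\mathrm{in}_{>_i}(I_{i-1}+(f_{i-1}))$ for $2\le i\le q$, every $f_i$ is a nonconstant polynomial that is a regular element on $R/I_i$, i.e. a nonzerodivisor on $R/I_i$ with $I_i+(f_i)\ne R$. In particular, $\operatorname{depth} R/I\ge q$, where $\operatorname{depth} R/I$ is the smallest integer $d$ such that $\mathrm{Ext}^d_R(R/\mathfrak m,R/I)\ne 0$ for some maximal ideal $\mathfrak m$ of $R$ (for homogeneous $I$ this is the usual depth with respect to the homogeneous maximal ideal). -/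

import Mathlib

open scoped MonomialOrder

namespace InitReg

section InitialIdeals

variable {σ k : Type*} [Field k]

/-- The initial ideal `ini_>(I)`: the ideal generated by the leading terms of the elements of `I`. -/
noncomputable def ini (ord : MonomialOrder σ) (I : Ideal (MvPolynomial σ k)) :
    Ideal (MvPolynomial σ k) :=
  Ideal.span (ord.leadingTerm '' (I : Set (MvPolynomial σ k)))

/-- The exponent vectors of the monomials of `J` that are minimal for divisibility. If `J` is a
monomial ideal, these are the exponents of its minimal monomial generators. -/
def minGens (J : Ideal (MvPolynomial σ k)) : Set (σ →₀ ℕ) :=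
  {a | Minimal (fun c : σ →₀ ℕ => MvPolynomial.monomial c (1 : k) ∈ J) a}

/-- `d_x(J)`: the largest exponent of the variable `x` in a minimal monomial generator of `J`
(a supremum in `ℕ∞`, so that no junk value can occur; it is `0` if `J = 0`). -/
noncomputable def varDegree (x : σ) (J : Ideal (MvPolynomial σ k)) : ℕ∞ :=
  ⨆ a ∈ minGens J, (a x : ℕ∞)

/-- The ideals of the definition of an initially regular sequence, numbered from `0`:
`I_0 = ini_{>_0}(I)` and `I_{i+1} = ini_{>_{i+1}}(I_i, f_i)`. -/
noncomputable def iniChain {q : ℕ} (ord : Fin q → MonomialOrder σ)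
    (f : Fin q → MvPolynomial σ k) (I : Ideal (MvPolynomial σ k)) :
    (i : ℕ) → i < q → Ideal (MvPolynomial σ k)
  | 0, h => ini (ord ⟨0, h⟩) I
  | i + 1, h =>
      ini (ord ⟨i + 1, h⟩)
        (iniChain ord f I i (Nat.lt_of_succ_lt h) ⊔ Ideal.span {f ⟨i, Nat.lt_of_succ_lt h⟩})

/-- `f` is a regular element on `R/J`: a nonzerodivisor on `R/J` with `(R/J)/f(R/J) ≠ 0`. -/
def IsRegularElementOn (f : MvPolynomial σ k) (J : Ideal (MvPolynomial σ k)) : Prop :=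
  IsSMulRegular (MvPolynomial σ k ⧸ J) f ∧ J ⊔ Ideal.span {f} ≠ ⊤

/-- `f_0, …, f_{q-1}` is an initially regular sequence on `R/I` with respect to the term orders
`>_0, …, >_{q-1}`: `I` is proper, every `f_i` is nonconstant and is regular on `R/I_i`. -/
def IsInitiallyRegular {q : ℕ} (ord : Fin q → MonomialOrder σ)
    (f : Fin q → MvPolynomial σ k) (I : Ideal (MvPolynomial σ k)) : Prop :=
  I ≠ ⊤ ∧ ∀ i : Fin q,
    f i ∉ Set.range (MvPolynomial.C : k → MvPolynomial σ k) ∧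
      IsRegularElementOn (f i) (iniChain ord f I i i.isLt)

end InitialIdeals

section Depth

universe u

/-- The depth of `M` at an ideal `𝔪`: `min {d | Ext^d_A(A/𝔪, M) ≠ 0}`, which is `⊤` if all these
`Ext` groups vanish (for finite `M` over a noetherian ring: if `𝔪 M = M`). -/
noncomputable def depthAt {A : Type u} [CommRing A] (𝔪 : Ideal A) (M : Type u)
    [AddCommGroup M] [Module A M] : ℕ∞ :=
  ⨅ d ∈ {d : ℕ | Nontrivial
    (CategoryTheory.Abelian.Ext.{u} (ModuleCat.of A (A ⧸ 𝔪)) (ModuleCat.of A M) d)}, (d : ℕ∞)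

/-- The depth of `M`, as the minimum of the depths at all maximal ideals. For a nonzero finite
module `M` over a polynomial ring `A` in `n` variables over a field it equals `n - pd M`, and for
a graded `M` it is the depth at the homogeneous maximal ideal. -/
noncomputable def depth (A : Type u) [CommRing A] (M : Type u)
    [AddCommGroup M] [Module A M] : ℕ∞ :=
  ⨅ 𝔪 : MaximalSpectrum A, depthAt 𝔪.asIdeal M

end Depth

end InitReg

/-!
Call a group `B` of variables with a distinguished member `x` adapted to a monomial ideal `J` if the
minimal generators of `J` have degree at most one in the other members of `B`, and contain one of
these whenever they contain `x`. Then the sum of the variables of `B` is a nonzerodivisor modulo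
`J`. If `F` is a polynomial that does not involve `B`, then `J + (F)` is homogeneous for the grading
by the exponents of the variables of `B`, whence `B` is also adapted to every initial ideal of
`J + (F)`. As the groups are disjoint, this makes the sequence initially regular.

For the depth, splitting `in(I)` by one variable of a group at a time shows that `q` disjoint
adapted groups among `n` variables force `in(I)` to have linear quotients in which each colon ideal
is generated by fewer than `n - q` variables. A Gröbner basis of `I` with these leading terms has
Schreyer syzygies that again have linear quotients, with one variable fewer. After `n - q` steps the
syzygies vanish, and shifting dimensions along this free resolution reduces the vanishing of
`Ext^d(R/𝔪, R/I)` for `d < q` to that of `Ext^d(R/𝔪, R)` for `d < n`.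
-/

namespace InitReg

section MonomialIdeals

open MvPolynomial

variable {σ k : Type*} [Field k]

/-- The set of exponent vectors of the monomials of `J`. -/
def exponents (J : Ideal (MvPolynomial σ k)) : Set (σ →₀ ℕ) :=
  {a | monomial a (1 : k) ∈ J}

theorem mem_exponents_iff {J : Ideal (MvPolynomial σ k)} {a : σ →₀ ℕ} :
    a ∈ exponents J ↔ monomial a (1 : k) ∈ J :=
  Iff.rfl

/-- A monomial ideal, described as an ideal that contains, with every polynomial, all the
monomials occurring in it. -/
def IsMonomialIdeal (J : Ideal (MvPolynomial σ k)) : Prop :=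
  ∀ p ∈ J, ∀ a ∈ p.support, a ∈ exponents J

theorem monomial_mem {J : Ideal (MvPolynomial σ k)} {a : σ →₀ ℕ} (ha : a ∈ exponents J) (c : k) :
    monomial a c ∈ J := by
  rw [← mul_one c, ← C_mul_monomial]
  exact J.mul_mem_left _ ha

theorem mem_of_support_subset_exponents {J : Ideal (MvPolynomial σ k)} {p : MvPolynomial σ k}
    (h : ∀ a ∈ p.support, a ∈ exponents J) : p ∈ J := by
  rw [← support_sum_monomial_coeff p]
  exact J.sum_mem fun a ha => monomial_mem (h a ha) _

theorem isUpperSet_exponents (J : Ideal (MvPolynomial σ k)) : IsUpperSet (exponents J) := by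
  intro a c hac ha
  have hfactor : monomial c (1 : k) = monomial (c - a) 1 * monomial a 1 := by
    rw [monomial_mul, tsub_add_cancel_of_le hac, one_mul]
  rw [mem_exponents_iff, hfactor]
  exact J.mul_mem_left _ ha

theorem zero_mem_exponents_iff {J : Ideal (MvPolynomial σ k)} : 0 ∈ exponents J ↔ J = ⊤ :=
  (Ideal.eq_top_iff_one J).symm

theorem exists_sub_mem_and_support_disjoint_exponents (J : Ideal (MvPolynomial σ k))
    (g : MvPolynomial σ k) : ∃ r, g - r ∈ J ∧ ∀ a ∈ r.support, a ∉ exponents J := by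
  classical
  induction g using MvPolynomial.induction_on' with
  | monomial a c =>
    by_cases ha : a ∈ exponents J
    · exact ⟨0, by simpa using monomial_mem ha c, by simp⟩
    · refine ⟨monomial a c, by simp, fun d hd => ?_⟩
      rwa [Finset.mem_singleton.mp (support_monomial_subset hd)]
  | add p q hp hq =>
    obtain ⟨r, hr, hrJ⟩ := hp
    obtain ⟨s, hs, hsJ⟩ := hq
    refine ⟨r + s, by simpa only [add_sub_add_comm] using J.add_mem hr hs, fun a ha => ?_⟩
    exact (Finset.mem_union.mp (support_add ha)).elim (hrJ a) (hsJ a)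

theorem mem_ini_iff {ord : MonomialOrder σ} {I : Ideal (MvPolynomial σ k)}
    {p : MvPolynomial σ k} :
    p ∈ ini ord I ↔ ∀ a ∈ p.support, ∃ f ∈ I, f ≠ 0 ∧ ord.degree f ≤ a := by
  have hspan : ini ord I = Ideal.span ((fun a => monomial a (1 : k)) ''
      (ord.degree '' ((I : Set (MvPolynomial σ k)) \ {0}))) := by
    rw [ini, MonomialOrder.span_leadingTerm_eq_span_monomial', Set.image_image]
  rw [hspan, mem_ideal_span_monomial_image]
  simp [and_assoc]

theorem mem_exponents_ini_iff {ord : MonomialOrder σ} {I : Ideal (MvPolynomial σ k)}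
    {a : σ →₀ ℕ} : a ∈ exponents (ini ord I) ↔ ∃ f ∈ I, f ≠ 0 ∧ ord.degree f = a := by
  classical
  rw [mem_exponents_iff, mem_ini_iff]
  simp only [support_monomial, one_ne_zero, if_false, Finset.mem_singleton, forall_eq]
  refine ⟨?_, fun ⟨f, hf, hf0, hdeg⟩ => ⟨f, hf, hf0, hdeg.le⟩⟩
  rintro ⟨f, hf, hf0, hle⟩
  have hm : monomial (a - ord.degree f) (1 : k) ≠ 0 := by simp
  refine ⟨monomial (a - ord.degree f) 1 * f, I.mul_mem_left _ hf, mul_ne_zero hm hf0, ?_⟩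
  rw [MonomialOrder.degree_mul hm hf0, MonomialOrder.degree_monomial, if_neg one_ne_zero,
    tsub_add_cancel_of_le hle]

theorem isMonomialIdeal_ini (ord : MonomialOrder σ) (I : Ideal (MvPolynomial σ k)) :
    IsMonomialIdeal (ini ord I) := by
  classical
  intro p hp a ha
  rw [mem_exponents_iff, mem_ini_iff]
  intro c hc
  rw [Finset.mem_singleton.mp (support_monomial_subset hc)]
  exact mem_ini_iff.mp hp a ha

theorem ini_ne_top {ord : MonomialOrder σ} {I : Ideal (MvPolynomial σ k)} (hI : I ≠ ⊤) :
    ini ord I ≠ ⊤ := by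
  intro htop
  obtain ⟨f, hf, hf0, hdeg⟩ := mem_exponents_ini_iff.mp (zero_mem_exponents_iff.mpr htop)
  refine hI (Ideal.eq_top_of_isUnit_mem _ hf ?_)
  rw [MonomialOrder.eq_C_of_degree_eq_zero hdeg]
  exact (MonomialOrder.leadingCoeff_ne_zero_iff.mpr hf0).isUnit.map C

theorem IsMonomialIdeal.sup_span_singleton_ne_top {J : Ideal (MvPolynomial σ k)}
    (hJ : IsMonomialIdeal J) (hJt : J ≠ ⊤) {f : MvPolynomial σ k} (hf : constantCoeff f = 0) :
    J ⊔ Ideal.span {f} ≠ ⊤ := by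
  have hJker : J ≤ RingHom.ker (constantCoeff : MvPolynomial σ k →+* k) := by
    intro p hp
    by_contra hp0
    exact hJt (zero_mem_exponents_iff.mp (hJ p hp 0 (mem_support_iff.mpr hp0)))
  have hle : J ⊔ Ideal.span {f} ≤ RingHom.ker (constantCoeff : MvPolynomial σ k →+* k) :=
    sup_le hJker ((Ideal.span_singleton_le_iff_mem _).mpr hf)
  exact ne_top_of_le_ne_top (RingHom.ker_ne_top _) hle

end MonomialIdeals

section Adapted

open MvPolynomial

variable {σ k : Type*} [Field k]

/-- The upper set `L` of exponent vectors is generated by vectors of degree at most `N` in the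
variable `y`. Multiplication by `y` in degrees `≥ N` then does not lead from the complement of `L`
into `L`, and this is what the definition says. -/
def VarDegreeLE (y : σ) (N : ℕ) (L : Set (σ →₀ ℕ)) : Prop :=
  ∀ a : σ →₀ ℕ, N ≤ a y → a + Finsupp.single y 1 ∈ L → a ∈ L

/-- The combinatorial hypothesis of the theorem for one group `B` of variables with distinguished
member `x`: the upper set `L` of exponent vectors is generated by vectors that have degree at most
one in the other members of `B`, and contain one of these if they contain `x`. Like
`VarDegreeLE`, it is phrased without mentioning generators. -/
structure Adapted (x : σ) (B : Finset σ) (L : Set (σ →₀ ℕ)) : Prop where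
  mem : x ∈ B
  varDegreeLE : ∀ y ∈ B, y ≠ x → VarDegreeLE y 1 L
  mem_of_add_single_mem : ∀ a : σ →₀ ℕ, (∀ y ∈ B, y ≠ x → a y = 0) →
    a + Finsupp.single x 1 ∈ L → a ∈ L

theorem exists_minGens_le {J : Ideal (MvPolynomial σ k)} {a : σ →₀ ℕ} (ha : a ∈ exponents J) :
    ∃ m ∈ minGens J, m ≤ a := by
  obtain ⟨m, hma, hm⟩ := exists_minimal_le_of_wellFoundedLT
    (fun c : σ →₀ ℕ => monomial c (1 : k) ∈ J) a ha
  exact ⟨m, hm, hma⟩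

theorem le_of_le_add_single {a m : σ →₀ ℕ} {y : σ} (hle : m ≤ a + Finsupp.single y 1)
    (hy : m y ≤ a y) : m ≤ a := by
  intro z
  rcases eq_or_ne y z with rfl | hyz
  · exact hy
  · simpa [hyz] using hle z

theorem varDegreeLE_exponents {J : Ideal (MvPolynomial σ k)} {y : σ} {N : ℕ}
    (h : varDegree y J ≤ N) : VarDegreeLE y N (exponents J) := by
  intro a hay ha
  obtain ⟨m, hm, hle⟩ := exists_minGens_le ha
  have hmy : (m y : ℕ∞) ≤ N :=
    (le_iSup₂ (f := fun (c : σ →₀ ℕ) (_ : c ∈ minGens J) => (c y : ℕ∞)) m hm).trans h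
  exact isUpperSet_exponents J
    (le_of_le_add_single hle ((Nat.cast_le.mp hmy).trans hay)) hm.1

theorem adapted_exponents {J : Ideal (MvPolynomial σ k)} {x : σ} {B : Finset σ} (hx : x ∈ B)
    (h₁ : ∀ y ∈ B, y ≠ x → varDegree y J ≤ 1)
    (h₂ : ∀ a ∈ minGens J, a x ≠ 0 → ∃ y ∈ B, y ≠ x ∧ a y ≠ 0) :
    Adapted x B (exponents J) where
  mem := hx
  varDegreeLE y hy hyx := varDegreeLE_exponents (by exact_mod_cast h₁ y hy hyx)
  mem_of_add_single_mem a ha hmem := by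
    obtain ⟨m, hm, hle⟩ := exists_minGens_le hmem
    have hmB : ∀ y ∈ B, y ≠ x → m y = 0 := fun y hy hyx => by
      simpa [ha y hy hyx, hyx.symm] using hle y
    have hmx : m x = 0 := by
      by_contra hne
      obtain ⟨y, hy, hyx, hmy⟩ := h₂ m hm hne
      exact hmy (hmB y hy hyx)
    exact isUpperSet_exponents J (le_of_le_add_single hle (hmx ▸ Nat.zero_le _)) hm.1

theorem coeff_sum_X_mul_of_forall_ne {B : Finset σ} {g : MvPolynomial σ k} {y : σ} (hy : y ∈ B)
    {a : σ →₀ ℕ} (h : ∀ z ∈ B, z ≠ y → ∀ c ∈ g.support,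
      c + Finsupp.single z 1 ≠ a + Finsupp.single y 1) :
    coeff (a + Finsupp.single y 1) ((∑ z ∈ B, X z) * g) = coeff a g := by
  classical
  rw [mul_comm, Finset.mul_sum, coeff_sum, Finset.sum_eq_single_of_mem y hy, coeff_mul_X]
  intro z hz hzy
  by_contra hne
  rw [coeff_mul_X', ite_eq_right_iff, Classical.not_imp, ← ne_eq, ← mem_support_iff] at hne
  refine h z hz hzy _ hne.2 (tsub_add_cancel_of_le (Finsupp.single_le_iff.mpr ?_))
  exact Nat.one_le_iff_ne_zero.mpr (Finsupp.mem_support_iff.mp hne.1)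

/-- If a variable `y ≠ x` of `B` occurs in `g`, multiply by `y` a monomial of `g` of largest
`y`-degree; otherwise multiply any monomial of `g` by `x`. In both cases nothing cancels this
product in `(∑ z ∈ B, z) * g`. -/
theorem Adapted.exists_mem_support_of_sum_X_mul_mem {J : Ideal (MvPolynomial σ k)}
    (hJ : IsMonomialIdeal J) {x : σ} {B : Finset σ} (h : Adapted x B (exponents J))
    {g : MvPolynomial σ k} (hg : g ≠ 0) (hmem : (∑ z ∈ B, X z) * g ∈ J) :
    ∃ a ∈ g.support, a ∈ exponents J := by
  have mem_of_forall_ne : ∀ y ∈ B, ∀ a ∈ g.support, (∀ z ∈ B, z ≠ y → ∀ c ∈ g.support,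
      c + Finsupp.single z 1 ≠ a + Finsupp.single y 1) → a + Finsupp.single y 1 ∈ exponents J := by
    intro y hy a ha hne
    refine hJ _ hmem _ (mem_support_iff.mpr ?_)
    rw [coeff_sum_X_mul_of_forall_ne hy hne]
    exact mem_support_iff.mp ha
  by_cases hocc : ∃ y ∈ B, y ≠ x ∧ ∃ a ∈ g.support, a y ≠ 0
  · obtain ⟨y, hy, hyx, a₀, ha₀, ha₀y⟩ := hocc
    obtain ⟨a, ha, hmax⟩ := g.support.exists_max_image (fun a => a y) ⟨a₀, ha₀⟩
    have hay : 1 ≤ a y := (Nat.one_le_iff_ne_zero.mpr ha₀y).trans (hmax a₀ ha₀)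
    refine ⟨a, ha, h.varDegreeLE y hy hyx a hay (mem_of_forall_ne y hy a ha ?_)⟩
    intro z _ hzy c hc heq
    have hcy : c y = a y + 1 := by simpa [hzy] using DFunLike.congr_fun heq y
    exact absurd (hmax c hc) (by omega)
  · push Not at hocc
    obtain ⟨a, ha⟩ := support_nonempty.mpr hg
    refine ⟨a, ha, h.mem_of_add_single_mem a (fun y hy hyx => hocc y hy hyx a ha)
      (mem_of_forall_ne x h.mem a ha ?_)⟩
    intro z hz hzx c _ heq
    have hcz : c z + 1 = a z := by simpa [hzx.symm] using DFunLike.congr_fun heq z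
    exact absurd (hocc z hz hzx a ha) (by omega)

theorem Adapted.mem_of_sum_X_mul_mem {J : Ideal (MvPolynomial σ k)} (hJ : IsMonomialIdeal J)
    {x : σ} {B : Finset σ} (h : Adapted x B (exponents J)) {g : MvPolynomial σ k}
    (hmem : (∑ z ∈ B, X z) * g ∈ J) : g ∈ J := by
  obtain ⟨r, hgr, hr⟩ := exists_sub_mem_and_support_disjoint_exponents J g
  have hr0 : r = 0 := by
    by_contra hr0
    have hrmem : (∑ z ∈ B, X z) * r ∈ J := by
      have := J.sub_mem hmem (J.mul_mem_left (∑ z ∈ B, X z) hgr)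
      rwa [← mul_sub, sub_sub_cancel] at this
    obtain ⟨a, ha, haJ⟩ := h.exists_mem_support_of_sum_X_mul_mem hJ hr0 hrmem
    exact hr a ha haJ
  rwa [hr0, sub_zero] at hgr

end Adapted

section Persistence

open MvPolynomial

variable {σ k : Type*} [Field k]

open Classical in
/-- The linear operator `x^(c + e_x) ↦ x^c` for the exponents `c` that agree with `a` on `Y`, which
kills all other monomials. It divides the `Y`-homogeneous component of degree `a + e_x` by the
variable `x`, and is linear over the polynomials that do not involve `Y`. -/
noncomputable def lowerOn (Y : Finset σ) (x : σ) (a : σ →₀ ℕ) :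
    MvPolynomial σ k →ₗ[k] MvPolynomial σ k :=
  (basisMonomials σ k).constr k fun d =>
    if ∀ y ∈ Y, d y = a y + Finsupp.single x 1 y then monomial (d - Finsupp.single x 1) 1 else 0

variable {Y : Finset σ} {x : σ} {a : σ →₀ ℕ}

open Classical in
theorem lowerOn_monomial (d : σ →₀ ℕ) (r : k) : lowerOn Y x a (monomial d r) =
    if ∀ y ∈ Y, d y = a y + Finsupp.single x 1 y then monomial (d - Finsupp.single x 1) r
    else 0 := by
  have hd : monomial d r = r • basisMonomials σ k d := by simp [smul_monomial]
  rw [hd, map_smul, lowerOn, Module.Basis.constr_basis, smul_ite, smul_zero, smul_monomial,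
    smul_eq_mul, mul_one]

theorem exists_eq_add_single_of_agree (hx : x ∈ Y) {d : σ →₀ ℕ}
    (hd : ∀ y ∈ Y, d y = a y + Finsupp.single x 1 y) :
    ∃ c, d = c + Finsupp.single x 1 ∧ ∀ y ∈ Y, c y = a y := by
  have hle : Finsupp.single x 1 ≤ d := by
    rw [Finsupp.single_le_iff, hd x hx]
    simp
  refine ⟨d - Finsupp.single x 1, (tsub_add_cancel_of_le hle).symm, fun y hy => ?_⟩
  rw [Finsupp.tsub_apply, hd y hy, Nat.add_sub_cancel]

open Classical in
theorem coeff_lowerOn (hx : x ∈ Y) (c : σ →₀ ℕ) (p : MvPolynomial σ k) :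
    coeff c (lowerOn Y x a p) =
      if ∀ y ∈ Y, c y = a y then coeff (c + Finsupp.single x 1) p else 0 := by
  induction p using MvPolynomial.induction_on' with
  | add p q hp hq => rw [map_add, coeff_add, hp, hq, ← ite_add_zero, coeff_add]
  | monomial d r =>
    rw [lowerOn_monomial]
    by_cases hd : ∀ y ∈ Y, d y = a y + Finsupp.single x 1 y
    · obtain ⟨d, rfl, hda⟩ := exists_eq_add_single_of_agree hx hd
      rw [if_pos hd, add_tsub_cancel_right, coeff_monomial, coeff_monomial]
      aesop
    · rw [if_neg hd, coeff_zero, coeff_monomial]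
      aesop

theorem lowerOn_mul (hx : x ∈ Y) {F : MvPolynomial σ k} (hF : ∀ c ∈ F.support, ∀ y ∈ Y, c y = 0)
    (s : MvPolynomial σ k) : lowerOn Y x a (F * s) = F * lowerOn Y x a s := by
  classical
  induction s using MvPolynomial.induction_on' with
  | add p q hp hq => rw [mul_add, map_add, map_add, hp, hq, mul_add]
  | monomial d r =>
    conv_lhs => rw [← support_sum_monomial_coeff F]
    conv_rhs => rw [← support_sum_monomial_coeff F]
    rw [Finset.sum_mul, Finset.sum_mul, map_sum]
    refine Finset.sum_congr rfl fun c hc => ?_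
    have hcd : (∀ y ∈ Y, (c + d) y = a y + Finsupp.single x 1 y) ↔
        ∀ y ∈ Y, d y = a y + Finsupp.single x 1 y :=
      forall₂_congr fun y hy => by rw [Finsupp.add_apply, hF c hc y hy, zero_add]
    simp only [monomial_mul, lowerOn_monomial, hcd]
    split_ifs with hd
    · obtain ⟨d, rfl, -⟩ := exists_eq_add_single_of_agree hx hd
      rw [← add_assoc, add_tsub_cancel_right, add_tsub_cancel_right, monomial_mul]
    · rw [mul_zero]

theorem mem_exponents_ini_sup_span {J : Ideal (MvPolynomial σ k)} (hJ : IsMonomialIdeal J)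
    (hx : x ∈ Y) {F : MvPolynomial σ k} (hF : ∀ c ∈ F.support, ∀ y ∈ Y, c y = 0)
    (h : ∀ c : σ →₀ ℕ, (∀ y ∈ Y, c y = a y) → c + Finsupp.single x 1 ∈ exponents J →
      c ∈ exponents J)
    {ord : MonomialOrder σ}
    (ha : a + Finsupp.single x 1 ∈ exponents (ini ord (J ⊔ Ideal.span {F}))) :
    a ∈ exponents (ini ord (J ⊔ Ideal.span {F})) := by
  classical
  obtain ⟨f, hf, hf0, hdeg⟩ := mem_exponents_ini_iff.mp ha
  have hcoeff : coeff a (lowerOn Y x a f) ≠ 0 := by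
    rw [coeff_lowerOn hx, if_pos fun _ _ => rfl, ← hdeg]
    exact MonomialOrder.coeff_degree_ne_zero_iff.mpr hf0
  have agree_and_mem_support : ∀ {p : MvPolynomial σ k}, ∀ c ∈ (lowerOn Y x a p).support,
      (∀ y ∈ Y, c y = a y) ∧ c + Finsupp.single x 1 ∈ p.support := by
    intro p c hc
    simpa only [mem_support_iff, coeff_lowerOn hx, ne_eq, ite_eq_right_iff, Classical.not_imp]
      using hc
  refine mem_exponents_ini_iff.mpr ⟨lowerOn Y x a f, ?_, fun h0 => ?_, ?_⟩
  · obtain ⟨p, hp, r, hr, rfl⟩ := Submodule.mem_sup.mp hf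
    obtain ⟨s, rfl⟩ := Ideal.mem_span_singleton.mp hr
    rw [map_add, lowerOn_mul hx hF]
    refine Submodule.add_mem_sup (mem_of_support_subset_exponents fun c hc => ?_)
      (Ideal.mul_mem_right _ _ (Ideal.mem_span_singleton_self F))
    obtain ⟨hca, hcp⟩ := agree_and_mem_support c hc
    exact h c hca (hJ p hp _ hcp)
  · rw [h0, coeff_zero] at hcoeff
    exact hcoeff rfl
  · refine ord.toSyn.injective (le_antisymm (MonomialOrder.degree_le_iff.mpr fun c hc => ?_)
      (MonomialOrder.le_degree (mem_support_iff.mpr hcoeff)))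
    have hle := MonomialOrder.le_degree (m := ord) (agree_and_mem_support c hc).2
    rwa [hdeg, map_add, map_add, add_le_add_iff_right] at hle

theorem VarDegreeLE.ini_sup_span {J : Ideal (MvPolynomial σ k)} (hJ : IsMonomialIdeal J)
    {y : σ} {N : ℕ} (h : VarDegreeLE y N (exponents J)) {F : MvPolynomial σ k}
    (hF : ∀ c ∈ F.support, c y = 0) (ord : MonomialOrder σ) :
    VarDegreeLE y N (exponents (ini ord (J ⊔ Ideal.span {F}))) := fun _ hay =>
  mem_exponents_ini_sup_span hJ (Finset.mem_singleton_self y)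
    (by simpa only [Finset.mem_singleton, forall_eq] using hF)
    fun c hc => h c (hay.trans_eq (hc y (Finset.mem_singleton_self y)).symm)

theorem Adapted.ini_sup_span {J : Ideal (MvPolynomial σ k)} (hJ : IsMonomialIdeal J)
    {x : σ} {B : Finset σ} (h : Adapted x B (exponents J)) {F : MvPolynomial σ k}
    (hF : ∀ c ∈ F.support, ∀ y ∈ B, c y = 0) (ord : MonomialOrder σ) :
    Adapted x B (exponents (ini ord (J ⊔ Ideal.span {F}))) where
  mem := h.mem
  varDegreeLE y hy hyx := (h.varDegreeLE y hy hyx).ini_sup_span hJ (fun c hc => hF c hc y hy) ord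
  mem_of_add_single_mem _ ha := mem_exponents_ini_sup_span hJ h.mem hF fun c hc =>
    h.mem_of_add_single_mem c fun y hy hyx => (hc y hy).trans (ha y hy hyx)

end Persistence

section Chain

open MvPolynomial

variable {σ k : Type*} [Field k]

theorem exists_eq_single_of_mem_support_sum_X {B : Finset σ} {c : σ →₀ ℕ}
    (hc : c ∈ (∑ y ∈ B, X y : MvPolynomial σ k).support) : ∃ y ∈ B, c = Finsupp.single y 1 := by
  classical
  obtain ⟨y, hy, hcy⟩ := Finset.mem_biUnion.mp (support_sum hc)
  rw [support_X, Finset.mem_singleton] at hcy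
  exact ⟨y, hy, hcy⟩

theorem constantCoeff_sum_X (B : Finset σ) :
    constantCoeff (∑ y ∈ B, X y : MvPolynomial σ k) = 0 := by
  simp only [map_sum, constantCoeff_X, Finset.sum_const_zero]

theorem sum_X_notMem_range_C {B : Finset σ} {x : σ} (hx : x ∈ B) :
    (∑ y ∈ B, X y : MvPolynomial σ k) ∉ Set.range C := by
  classical
  rintro ⟨r, hr⟩
  have hcoeff := congrArg (coeff (Finsupp.single x 1)) hr
  rw [coeff_C, if_neg (Finsupp.single_ne_zero.mpr one_ne_zero).symm, coeff_sum,
    Finset.sum_eq_single_of_mem x hx, coeff_X, if_pos rfl] at hcoeff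
  · exact zero_ne_one hcoeff
  · intro y _ hyx
    rw [coeff_X, if_neg (mt (Finsupp.single_left_injective one_ne_zero ·) hyx)]

variable {q : ℕ} {x : Fin q → σ} {B : Fin q → Finset σ}

theorem iniChain_spec (hB : Pairwise fun i j => Disjoint (B i) (B j))
    {I : Ideal (MvPolynomial σ k)} (hI : I ≠ ⊤) (ord : Fin q → MonomialOrder σ)
    (h : ∀ hq : 0 < q, ∀ i, Adapted (x i) (B i) (exponents (ini (ord ⟨0, hq⟩) I)))
    (m : ℕ) (hm : m < q) :
    IsMonomialIdeal (iniChain ord (fun i => ∑ y ∈ B i, X y) I m hm) ∧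
      iniChain ord (fun i => ∑ y ∈ B i, X y) I m hm ≠ ⊤ ∧
      ∀ i : Fin q, m ≤ i →
        Adapted (x i) (B i) (exponents (iniChain ord (fun i => ∑ y ∈ B i, X y) I m hm)) := by
  induction m with
  | zero => exact ⟨isMonomialIdeal_ini _ _, ini_ne_top hI, fun i _ => h hm i⟩
  | succ m ih =>
    obtain ⟨hmon, htop, had⟩ := ih (Nat.lt_of_succ_lt hm)
    refine ⟨isMonomialIdeal_ini _ _,
      ini_ne_top (hmon.sup_span_singleton_ne_top htop (constantCoeff_sum_X _)),
      fun i hi => (had i (Nat.le_of_succ_le hi)).ini_sup_span hmon (fun c hc y hy => ?_) _⟩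
    obtain ⟨z, hz, rfl⟩ := exists_eq_single_of_mem_support_sum_X hc
    have hne : (⟨m, Nat.lt_of_succ_lt hm⟩ : Fin q) ≠ i := fun e => by
      rw [← e] at hi
      exact Nat.not_succ_le_self m hi
    exact Finsupp.single_eq_of_ne' (Finset.disjoint_iff_ne.mp (hB hne) z hz y hy)

theorem isInitiallyRegular_of_adapted (hB : Pairwise fun i j => Disjoint (B i) (B j))
    {I : Ideal (MvPolynomial σ k)} (hI : I ≠ ⊤) (ord : Fin q → MonomialOrder σ)
    (h : ∀ hq : 0 < q, ∀ i, Adapted (x i) (B i) (exponents (ini (ord ⟨0, hq⟩) I))) :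
    IsInitiallyRegular ord (fun i => ∑ y ∈ B i, X y) I := by
  refine ⟨hI, fun i => ?_⟩
  obtain ⟨hmon, htop, had⟩ := iniChain_spec hB hI ord h i i.isLt
  refine ⟨sum_X_notMem_range_C (had i le_rfl).mem, ?_,
    hmon.sup_span_singleton_ne_top htop (constantCoeff_sum_X _)⟩
  exact (isSMulRegular_quotient_iff_mem_of_smul_mem _ _).mpr fun g hg =>
    (had i le_rfl).mem_of_sum_X_mul_mem hmon hg

end Chain

section LinearQuotients

variable {σ : Type*}

/-- The exponent set of the colon ideal `J : z`, for the exponent set `L` of a monomial ideal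
`J`. -/
def colonVar (z : σ) (L : Set (σ →₀ ℕ)) : Set (σ →₀ ℕ) :=
  {a | a + Finsupp.single z 1 ∈ L}

/-- The exponent set of the ideal generated by the monomials of `J` that do not contain `z`, for
the exponent set `L` of a monomial ideal `J`. -/
def eraseVar (z : σ) (L : Set (σ →₀ ℕ)) : Set (σ →₀ ℕ) :=
  {a | a.erase z ∈ L}

theorem mem_colonVar {z : σ} {L : Set (σ →₀ ℕ)} {a : σ →₀ ℕ} :
    a ∈ colonVar z L ↔ a + Finsupp.single z 1 ∈ L :=
  Iff.rfl

theorem mem_eraseVar {z : σ} {L : Set (σ →₀ ℕ)} {a : σ →₀ ℕ} :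
    a ∈ eraseVar z L ↔ a.erase z ∈ L :=
  Iff.rfl

theorem add_single_mem_eraseVar_self {z : σ} {L : Set (σ →₀ ℕ)} {a : σ →₀ ℕ} :
    a + Finsupp.single z 1 ∈ eraseVar z L ↔ a ∈ eraseVar z L := by
  rw [mem_eraseVar, mem_eraseVar, Finsupp.erase_add, Finsupp.erase_single, add_zero]

theorem add_single_mem_eraseVar_of_ne {y z : σ} (hyz : y ≠ z) {L : Set (σ →₀ ℕ)} {a : σ →₀ ℕ} :
    a + Finsupp.single y 1 ∈ eraseVar z L ↔ a.erase z + Finsupp.single y 1 ∈ L := by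
  rw [mem_eraseVar, Finsupp.erase_add, Finsupp.erase_single_ne hyz.symm]

theorem eraseVar_subset {L : Set (σ →₀ ℕ)} (hL : IsUpperSet L) (z : σ) : eraseVar z L ⊆ L := by
  intro a ha
  have hle : a.erase z ≤ a.erase z + Finsupp.single z (a z) := le_self_add
  rw [Finsupp.erase_add_single] at hle
  exact hL hle ha

theorem isUpperSet_colonVar {L : Set (σ →₀ ℕ)} (hL : IsUpperSet L) (z : σ) :
    IsUpperSet (colonVar z L) := fun _ _ hac ha =>
  hL (add_le_add_left hac _) ha

theorem isUpperSet_eraseVar {L : Set (σ →₀ ℕ)} (hL : IsUpperSet L) (z : σ) :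
    IsUpperSet (eraseVar z L) := by
  intro a c hac ha
  refine hL (fun y => ?_) ha
  rcases eq_or_ne y z with rfl | hy
  · simp only [Finsupp.erase_same, le_refl]
  · simpa only [Finsupp.erase_ne hy] using hac y

theorem zero_notMem_eraseVar {L : Set (σ →₀ ℕ)} (h0 : (0 : σ →₀ ℕ) ∉ L) (z : σ) :
    (0 : σ →₀ ℕ) ∉ eraseVar z L := by
  rwa [mem_eraseVar, Finsupp.erase_zero]

theorem single_one_le_of_ne_zero {c : σ →₀ ℕ} {z : σ} (hz : c z ≠ 0) : Finsupp.single z 1 ≤ c :=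
  Finsupp.single_le_iff.mpr (Nat.one_le_iff_ne_zero.mpr hz)

theorem image_colonVar_union_eraseVar {L : Set (σ →₀ ℕ)} (hL : IsUpperSet L) (z : σ) :
    (· + Finsupp.single z 1) '' colonVar z L ∪ eraseVar z L = L := by
  refine Set.Subset.antisymm
    (Set.union_subset (Set.image_subset_iff.mpr fun _ => id) (eraseVar_subset hL z)) ?_
  intro c hc
  rcases eq_or_ne (c z) 0 with hcz | hcz
  · right
    rwa [mem_eraseVar, Finsupp.erase_of_notMem_support (Finsupp.notMem_support_iff.mpr hcz)]
  · left
    have hcancel := tsub_add_cancel_of_le (single_one_le_of_ne_zero hcz)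
    exact ⟨c - Finsupp.single z 1, by rwa [mem_colonVar, hcancel], hcancel⟩

/-- `L` is the exponent set of a monomial ideal with monomial generators, in the variables of `A`,
that can be ordered in such a way that the ideal of the previous generators, divided by any
generator, is generated by fewer than `s` variables. -/
inductive HasLinearQuotients (A : Finset σ) (s : ℕ) : Set (σ →₀ ℕ) → Prop
  | empty : HasLinearQuotients A s ∅
  | union_Ici {L : Set (σ →₀ ℕ)} {a : σ →₀ ℕ} {Z : Finset σ} (hL : HasLinearQuotients A s L)
      (ha : a.support ⊆ A) (hZ : Z.card < s) (h : ∀ u, a + u ∈ L ↔ ∃ z ∈ Z, u z ≠ 0) :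
      HasLinearQuotients A s (L ∪ Set.Ici a)

namespace HasLinearQuotients

theorem mono {A A' : Finset σ} {s s' : ℕ} {L : Set (σ →₀ ℕ)} (h : HasLinearQuotients A s L)
    (hA : A ⊆ A') (hs : s ≤ s') : HasLinearQuotients A' s' L := by
  induction h with
  | empty => exact .empty
  | union_Ici _ ha hZ h ih => exact .union_Ici ih (ha.trans hA) (hZ.trans_le hs) h

theorem of_zero_mem {A : Finset σ} {s : ℕ} (hs : 0 < s) {L : Set (σ →₀ ℕ)} (hL : IsUpperSet L)
    (h0 : (0 : σ →₀ ℕ) ∈ L) : HasLinearQuotients A s L := by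
  have hIci : L = ∅ ∪ Set.Ici 0 := by
    ext a
    simp [hL (zero_le : 0 ≤ a) h0]
  rw [hIci]
  exact .union_Ici (Z := ∅) .empty (by simp) (by simpa using hs) (by simp)

theorem image_add_single {A : Finset σ} {s : ℕ} {L : Set (σ →₀ ℕ)}
    (h : HasLinearQuotients A s L) {z : σ} (hz : z ∈ A) :
    HasLinearQuotients A s ((· + Finsupp.single z 1) '' L) := by
  classical
  induction h with
  | empty => simpa only [Set.image_empty] using HasLinearQuotients.empty
  | @union_Ici L a Z _ ha hZ h ih =>
    have himage : (· + Finsupp.single z 1) '' Set.Ici a = Set.Ici (a + Finsupp.single z 1) := by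
      ext c
      constructor
      · rintro ⟨d, hd, rfl⟩
        exact add_le_add_left (Set.mem_Ici.mp hd) _
      · intro hc
        rw [Set.mem_Ici] at hc
        exact ⟨c - Finsupp.single z 1, Set.mem_Ici.mpr (le_tsub_of_add_le_right hc),
          tsub_add_cancel_of_le (le_add_self.trans hc)⟩
    rw [Set.image_union, himage]
    refine .union_Ici ih ?_ hZ fun u => ?_
    · refine Finsupp.support_add.trans (Finset.union_subset ha ?_)
      exact Finsupp.support_single_subset.trans (Finset.singleton_subset_iff.mpr hz)
    · rw [add_right_comm, ← h u]
      exact (add_left_injective (Finsupp.single z 1)).mem_set_image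

theorem image_colonVar_union [DecidableEq σ] {A : Finset σ} {t : ℕ} {L M : Set (σ →₀ ℕ)}
    (hL : IsUpperSet L) {z : σ} (hz : z ∈ A) (hcolon : HasLinearQuotients A (t + 1) (colonVar z L))
    (hM : HasLinearQuotients (A.erase z) t M) (hML : M ⊆ L) :
    HasLinearQuotients A (t + 1) ((· + Finsupp.single z 1) '' colonVar z L ∪ M) := by
  induction hM with
  | empty =>
    rw [Set.union_empty]
    exact hcolon.image_add_single hz
  | @union_Ici M a Z _ ha hZ h ih =>
    rw [Set.union_subset_iff] at hML
    rw [← Set.union_assoc]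
    refine .union_Ici (Z := insert z Z) (ih hML.1) (ha.trans (Finset.erase_subset _ _))
      ((Finset.card_insert_le _ _).trans_lt (Nat.succ_lt_succ hZ)) fun u => ?_
    have haz : a z = 0 :=
      Finsupp.notMem_support_iff.mp fun hmem => Finset.notMem_erase z A (ha hmem)
    rw [Set.mem_union, h u, Finset.exists_mem_insert]
    refine or_congr_left ⟨?_, fun hu => ?_⟩
    · rintro ⟨c, -, hc⟩
      have hcz : c z + 1 = u z := by simpa [haz] using DFunLike.congr_fun hc z
      omega
    · have hcancel : a + (u - Finsupp.single z 1) + Finsupp.single z 1 = a + u := by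
        rw [add_assoc, tsub_add_cancel_of_le (single_one_le_of_ne_zero hu)]
      refine ⟨_, mem_colonVar.mpr ?_, hcancel⟩
      rw [hcancel]
      exact hL le_self_add (hML.2 Set.self_mem_Ici)

theorem of_colonVar_of_eraseVar [DecidableEq σ] {A : Finset σ} {t : ℕ} {L : Set (σ →₀ ℕ)}
    (hL : IsUpperSet L) {z : σ} (hz : z ∈ A)
    (hcolon : (0 : σ →₀ ℕ) ∉ colonVar z L → HasLinearQuotients A (t + 1) (colonVar z L))
    (herase : HasLinearQuotients (A.erase z) t (eraseVar z L)) :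
    HasLinearQuotients A (t + 1) L := by
  rw [← image_colonVar_union_eraseVar hL z]
  refine image_colonVar_union hL hz ?_ herase (eraseVar_subset hL z)
  by_cases h0 : (0 : σ →₀ ℕ) ∈ colonVar z L
  · exact .of_zero_mem t.succ_pos (isUpperSet_colonVar hL z) h0
  · exact hcolon h0

end HasLinearQuotients

namespace VarDegreeLE

variable {y z : σ} {N : ℕ} {L : Set (σ →₀ ℕ)}

theorem colonVar (h : VarDegreeLE y N L) : VarDegreeLE y N (colonVar z L) := by
  intro a ha hmem
  rw [mem_colonVar, add_right_comm] at hmem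
  exact h _ (ha.trans (Nat.le_add_right _ _)) hmem

theorem colonVar_self (h : VarDegreeLE z (N + 1) L) : VarDegreeLE z N (InitReg.colonVar z L) :=
  fun a ha hmem => h _ (by simpa using ha) hmem

theorem eraseVar (h : VarDegreeLE y N L) : VarDegreeLE y N (eraseVar z L) := by
  intro a ha hmem
  rcases eq_or_ne y z with rfl | hyz
  · exact add_single_mem_eraseVar_self.mp hmem
  · exact h _ (by rwa [Finsupp.erase_ne hyz]) ((add_single_mem_eraseVar_of_ne hyz).mp hmem)

theorem eraseVar_self : VarDegreeLE z N (InitReg.eraseVar z L) := fun _ _ =>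
  add_single_mem_eraseVar_self.mp

theorem mem_of_add_single_mem (h : VarDegreeLE y 0 L) {m : ℕ} {a : σ →₀ ℕ}
    (ha : a + Finsupp.single y m ∈ L) : a ∈ L := by
  induction m with
  | zero => rwa [Finsupp.single_zero, add_zero] at ha
  | succ m ih =>
    rw [Finsupp.single_add, ← add_assoc] at ha
    exact ih (h _ (Nat.zero_le _) ha)

end VarDegreeLE

theorem zero_mem_of_forall_varDegreeLE_zero {L : Set (σ →₀ ℕ)} (h : ∀ y, VarDegreeLE y 0 L)
    {a : σ →₀ ℕ} (ha : a ∈ L) : (0 : σ →₀ ℕ) ∈ L := by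
  induction a using Finsupp.induction with
  | zero => exact ha
  | single_add y m f _ _ ih =>
    rw [add_comm] at ha
    exact ih ((h y).mem_of_add_single_mem ha)

theorem exists_varDegreeLE [Finite σ] {L : Set (σ →₀ ℕ)} (hL : IsUpperSet L) (y : σ) :
    ∃ N, VarDegreeLE y N L := by
  have hfin : {a | Minimal (· ∈ L) a}.Finite :=
    WellQuasiOrderedLE.finite_of_isAntichain (setOfPred_minimal_antichain (· ∈ L))
  obtain ⟨N, hN⟩ := (hfin.image fun a => a y).bddAbove
  refine ⟨N, fun a hay ha => ?_⟩
  obtain ⟨m, hma, hm⟩ := exists_minimal_le_of_wellFoundedLT (· ∈ L) _ ha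
  exact hL (le_of_le_add_single hma ((hN ⟨m, hm, rfl⟩).trans hay)) hm.1

theorem hasLinearQuotients_card [Finite σ] {A : Finset σ} {L : Set (σ →₀ ℕ)} (hL : IsUpperSet L)
    (h0 : (0 : σ →₀ ℕ) ∉ L) (hA : ∀ y ∉ A, VarDegreeLE y 0 L) :
    HasLinearQuotients A A.card L := by
  classical
  induction A using Finset.induction_on generalizing L with
  | empty =>
    have hempty : L = ∅ := Set.eq_empty_of_forall_notMem fun a ha =>
      h0 (zero_mem_of_forall_varDegreeLE_zero (fun y => hA y (Finset.notMem_empty y)) ha)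
    rw [hempty]
    exact .empty
  | insert z A hz ih =>
    obtain ⟨N, hN⟩ := exists_varDegreeLE hL z
    rw [Finset.card_insert_of_notMem hz]
    induction N generalizing L with
    | zero =>
      refine (ih hL h0 fun y hy => ?_).mono (Finset.subset_insert _ _) (Nat.le_succ _)
      rcases eq_or_ne y z with rfl | hyz
      · exact hN
      · exact hA y (Finset.mem_insert.not.mpr (not_or.mpr ⟨hyz, hy⟩))
    | succ N ihN =>
      refine .of_colonVar_of_eraseVar hL (Finset.mem_insert_self z A) (fun hcolon0 => ?_) ?_
      · exact ihN (isUpperSet_colonVar hL z) hcolon0 (fun y hy => (hA y hy).colonVar)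
          hN.colonVar_self
      · rw [Finset.erase_insert hz]
        refine ih (isUpperSet_eraseVar hL z) (zero_notMem_eraseVar h0 z) fun y hy => ?_
        rcases eq_or_ne y z with rfl | hyz
        · exact .eraseVar_self
        · exact (hA y (Finset.mem_insert.not.mpr (not_or.mpr ⟨hyz, hy⟩))).eraseVar

theorem Adapted.colonVar {x z : σ} {B : Finset σ} {L : Set (σ →₀ ℕ)} (h : Adapted x B L)
    (hz : z ∉ B) : Adapted x B (colonVar z L) where
  mem := h.mem
  varDegreeLE y hy hyx := (h.varDegreeLE y hy hyx).colonVar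
  mem_of_add_single_mem a ha hmem := by
    rw [mem_colonVar, add_right_comm] at hmem
    refine h.mem_of_add_single_mem _ (fun y hy hyx => ?_) hmem
    have hzy : z ≠ y := fun e => hz (e ▸ hy)
    rw [Finsupp.add_apply, ha y hy hyx, Finsupp.single_eq_of_ne' hzy, add_zero]

theorem Adapted.eraseVar [DecidableEq σ] {x z : σ} {B : Finset σ} {L : Set (σ →₀ ℕ)}
    (h : Adapted x B L) (hxz : x ≠ z) : Adapted x (B.erase z) (eraseVar z L) where
  mem := Finset.mem_erase.mpr ⟨hxz, h.mem⟩
  varDegreeLE y hy hyx := (h.varDegreeLE y (Finset.mem_of_mem_erase hy) hyx).eraseVar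
  mem_of_add_single_mem a ha hmem := by
    refine h.mem_of_add_single_mem _ (fun y hy hyx => ?_)
      ((add_single_mem_eraseVar_of_ne hxz).mp hmem)
    rcases eq_or_ne y z with rfl | hyz
    · exact Finsupp.erase_same
    · rw [Finsupp.erase_ne hyz, ha y (Finset.mem_erase.mpr ⟨hyz, hy⟩) hyx]

/-- An upper set `L` of exponent vectors whose minimal elements involve only the variables of `A`,
together with pairwise disjoint groups `B i ⊆ A`, for `i ∈ G`, that are adapted to `L`. -/
structure AdaptedFamily {ι : Type*} (A : Finset σ) (G : Finset ι) (x : ι → σ) (B : ι → Finset σ)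
    (L : Set (σ →₀ ℕ)) : Prop where
  isUpperSet : IsUpperSet L
  varDegreeLE_zero : ∀ y ∉ A, VarDegreeLE y 0 L
  subset : ∀ i ∈ G, B i ⊆ A
  pairwiseDisjoint : (G : Set ι).PairwiseDisjoint B
  adapted : ∀ i ∈ G, Adapted (x i) (B i) L

namespace AdaptedFamily

variable {ι : Type*} {A : Finset σ} {G : Finset ι} {x : ι → σ} {B : ι → Finset σ}
  {L : Set (σ →₀ ℕ)}

theorem notMem_of_mem (h : AdaptedFamily A G x B L) {i j : ι} (hi : i ∈ G) (hj : j ∈ G)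
    (hij : i ≠ j) {z : σ} (hz : z ∈ B i) : z ∉ B j :=
  Finset.disjoint_left.mp (h.pairwiseDisjoint hi hj hij) hz

theorem card_le_card (h : AdaptedFamily A G x B L) : G.card ≤ A.card := by
  refine Finset.card_le_card_of_injOn x (fun i hi => h.subset i hi (h.adapted i hi).mem) ?_
  intro i hi j hj hij
  by_contra hne
  exact h.notMem_of_mem hi hj hne (h.adapted i hi).mem (hij ▸ (h.adapted j hj).mem)

theorem ne_of_mem (h : AdaptedFamily A G x B L) {i : ι} (hi : i ∈ G) {z : σ} (hz : z ∈ B i)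
    (hzx : z ≠ x i) : ∀ j ∈ G, x j ≠ z := by
  rintro j hj rfl
  have hji : j ≠ i := fun e => hzx (e ▸ rfl)
  exact h.notMem_of_mem hj hi hji (h.adapted j hj).mem hz

variable [DecidableEq σ]

theorem subset_erase [DecidableEq ι] (h : AdaptedFamily A G x B L) {i : ι} (hi : i ∈ G) {z : σ}
    (hz : z ∈ B i) : ∀ j ∈ G.erase i, B j ⊆ A.erase z := by
  intro j hj y hy
  obtain ⟨hji, hjG⟩ := Finset.mem_erase.mp hj
  exact Finset.mem_erase.mpr
    ⟨fun e => h.notMem_of_mem hi hjG hji.symm hz (e ▸ hy), h.subset j hjG hy⟩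

theorem erase_erase [DecidableEq ι] (h : AdaptedFamily A G x B L) {i : ι} (hi : i ∈ G) {z : σ}
    (hz : z ∈ B i) (hdeg : VarDegreeLE z 0 L) : AdaptedFamily (A.erase z) (G.erase i) x B L where
  isUpperSet := h.isUpperSet
  varDegreeLE_zero y hy := by
    rcases eq_or_ne y z with rfl | hyz
    · exact hdeg
    · exact h.varDegreeLE_zero y fun hyA => hy (Finset.mem_erase.mpr ⟨hyz, hyA⟩)
  subset := h.subset_erase hi hz
  pairwiseDisjoint := h.pairwiseDisjoint.subset (Finset.coe_subset.mpr (G.erase_subset i))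
  adapted j hj := h.adapted j (Finset.mem_of_mem_erase hj)

theorem colonVar_of_mem [DecidableEq ι] (h : AdaptedFamily A G x B L) {i : ι} (hi : i ∈ G) {z : σ}
    (hz : z ∈ B i) (hzx : z ≠ x i) :
    AdaptedFamily (A.erase z) (G.erase i) x B (colonVar z L) where
  isUpperSet := isUpperSet_colonVar h.isUpperSet z
  varDegreeLE_zero y hy := by
    rcases eq_or_ne y z with rfl | hyz
    · exact ((h.adapted i hi).varDegreeLE y hz hzx).colonVar_self
    · exact (h.varDegreeLE_zero y fun hyA => hy (Finset.mem_erase.mpr ⟨hyz, hyA⟩)).colonVar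
  subset := h.subset_erase hi hz
  pairwiseDisjoint := h.pairwiseDisjoint.subset (Finset.coe_subset.mpr (G.erase_subset i))
  adapted j hj := (h.adapted j (Finset.mem_of_mem_erase hj)).colonVar
    (h.notMem_of_mem hi (Finset.mem_of_mem_erase hj) (Finset.ne_of_mem_erase hj).symm hz)

theorem eraseVar (h : AdaptedFamily A G x B L) {z : σ} (hz : ∀ i ∈ G, x i ≠ z) :
    AdaptedFamily (A.erase z) G x (fun i => (B i).erase z) (eraseVar z L) where
  isUpperSet := isUpperSet_eraseVar h.isUpperSet z
  varDegreeLE_zero y hy := by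
    rcases eq_or_ne y z with rfl | hyz
    · exact .eraseVar_self
    · exact (h.varDegreeLE_zero y fun hyA => hy (Finset.mem_erase.mpr ⟨hyz, hyA⟩)).eraseVar
  subset i hi := Finset.erase_subset_erase _ (h.subset i hi)
  pairwiseDisjoint := h.pairwiseDisjoint.mono fun _ => Finset.erase_subset _ _
  adapted i hi := (h.adapted i hi).eraseVar (hz i hi)

end AdaptedFamily

theorem AdaptedFamily.hasLinearQuotients [Finite σ] {ι : Type*} {x : ι → σ} {A : Finset σ}
    {G : Finset ι} {B : ι → Finset σ} {L : Set (σ →₀ ℕ)} (h : AdaptedFamily A G x B L)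
    (h0 : (0 : σ →₀ ℕ) ∉ L) {s : ℕ} (hs : A.card ≤ s + G.card) : HasLinearQuotients A s L := by
  classical
  induction A using Finset.strongInduction generalizing G B s L with
  | H A ih =>
  rcases G.eq_empty_or_nonempty with rfl | ⟨i, hi⟩
  · exact (hasLinearQuotients_card h.isUpperSet h0 h.varDegreeLE_zero).mono subset_rfl hs
  have hxi := (h.adapted i hi).mem
  have hcard : ∀ z ∈ B i, (A.erase z).card ≤ s + (G.erase i).card := fun z hz => by
    rw [Finset.card_erase_of_mem (h.subset i hi hz), Finset.card_erase_of_mem hi]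
    omega
  by_cases hsingle : ∀ z ∈ B i, z = x i
  · have hdeg : VarDegreeLE (x i) 0 L := fun a _ =>
      (h.adapted i hi).mem_of_add_single_mem a fun y hy hyx => absurd (hsingle y hy) hyx
    exact (ih _ (Finset.erase_ssubset (h.subset i hi hxi)) (h.erase_erase hi hxi hdeg) h0
      (hcard _ hxi)).mono (Finset.erase_subset _ _) le_rfl
  · push Not at hsingle
    obtain ⟨z, hz, hzx⟩ := hsingle
    have hzA : z ∈ A := h.subset i hi hz
    have herase := h.eraseVar (h.ne_of_mem hi hz hzx)
    have hGcard := herase.card_le_card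
    rw [Finset.card_erase_of_mem hzA] at hGcard
    have hApos := Finset.card_pos.mpr ⟨z, hzA⟩
    obtain ⟨t, rfl⟩ : ∃ t, s = t + 1 := Nat.exists_eq_add_one.mpr (by omega)
    refine .of_colonVar_of_eraseVar h.isUpperSet hzA (fun hcolon0 => ?_) ?_
    · exact (ih _ (Finset.erase_ssubset hzA) (h.colonVar_of_mem hi hz hzx) hcolon0
        (hcard z hz)).mono (Finset.erase_subset _ _) le_rfl
    · refine ih _ (Finset.erase_ssubset hzA) herase (zero_notMem_eraseVar h0 z) ?_
      rw [Finset.card_erase_of_mem hzA]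
      omega

end LinearQuotients

section LeadingPositions

open MvPolynomial

/-- Coordinates of a module over a polynomial ring with respect to a linearly ordered set `X` of
positions on which the exponent vectors act, such that multiplication by a monomial moves the
coordinates along the action. They play the role of a monomial order for submodules of free
modules. -/
structure MonomialCoords (σ k X U : Type*) [Field k] [LinearOrder X] [AddCommGroup U]
    [Module (MvPolynomial σ k) U] where
  act : (σ →₀ ℕ) → X → X
  act_add : ∀ a c x, act (a + c) x = act a (act c x)
  act_strictMono : ∀ a, StrictMono (act a)
  act_injective : ∀ x, Function.Injective (act · x)
  coord : U →+ (X →₀ k)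
  coord_injective : Function.Injective coord
  coord_monomial_smul : ∀ (a : σ →₀ ℕ) (c : k) (u : U),
    coord (monomial a c • u) = c • (coord u).mapDomain (act a)

namespace MonomialCoords

variable {σ k X U : Type*} [Field k] [LinearOrder X] [AddCommGroup U]
  [Module (MvPolynomial σ k) U] (P : MonomialCoords σ k X U)

/-- The leading position of `u`, which is `⊥` for `u = 0`. -/
noncomputable def lead (u : U) : WithBot X := (P.coord u).support.max

variable {P} {u v : U} {y : X}

theorem le_lead (hy : P.coord u y ≠ 0) : y ≤ P.lead u :=
  Finset.le_max (Finsupp.mem_support_iff.mpr hy)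

theorem lead_le_iff {w : WithBot X} : P.lead u ≤ w ↔ ∀ z, P.coord u z ≠ 0 → z ≤ w := by
  simp only [lead, Finset.max_le_iff, Finsupp.mem_support_iff]

theorem lead_lt_coe_iff : P.lead u < y ↔ ∀ z, P.coord u z ≠ 0 → z < y := by
  simp only [lead, Finset.max_eq_sup_coe, Finset.sup_lt_iff (WithBot.bot_lt_coe y),
    Finsupp.mem_support_iff, WithBot.coe_lt_coe]

theorem coord_ne_zero_of_lead_eq (h : P.lead u = y) : P.coord u y ≠ 0 :=
  Finsupp.mem_support_iff.mp (Finset.mem_of_max h)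

theorem lead_eq_coe_iff : P.lead u = y ↔ P.coord u y ≠ 0 ∧ ∀ z, P.coord u z ≠ 0 → z ≤ y := by
  refine ⟨fun h => ⟨coord_ne_zero_of_lead_eq h, fun z hz => ?_⟩, fun ⟨hy, h⟩ => ?_⟩
  · exact WithBot.coe_le_coe.mp (h ▸ le_lead hz)
  · exact le_antisymm (lead_le_iff.mpr fun z hz => WithBot.coe_le_coe.mpr (h z hz)) (le_lead hy)

theorem lead_eq_bot_iff : P.lead u = ⊥ ↔ u = 0 := by
  rw [lead, Finset.max_eq_bot, Finsupp.support_eq_empty, map_eq_zero_iff _ P.coord_injective]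

theorem exists_lead_eq_coe (hu : u ≠ 0) : ∃ y : X, P.lead u = y :=
  (WithBot.ne_bot_iff_exists.mp (lead_eq_bot_iff.not.mpr hu)).imp fun _ => Eq.symm

theorem lead_sum_eq {ι : Type*} {s : Finset ι} {f : ι → U} {i : ι} (hi : i ∈ s)
    (hy : P.lead (f i) = y) (hlt : ∀ j ∈ s, j ≠ i → P.lead (f j) < y) :
    P.lead (∑ j ∈ s, f j) = y := by
  have hcoord : ∀ z, P.coord (∑ j ∈ s, f j) z = ∑ j ∈ s, P.coord (f j) z := fun z => by
    rw [map_sum, Finsupp.finsetSum_apply]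
  refine lead_eq_coe_iff.mpr ⟨?_, fun z hz => ?_⟩
  · rw [hcoord, Finset.sum_eq_single_of_mem i hi fun j hj hji => ?_]
    · exact coord_ne_zero_of_lead_eq hy
    · by_contra hne
      exact lt_irrefl y (lead_lt_coe_iff.mp (hlt j hj hji) y hne)
  · rw [hcoord] at hz
    obtain ⟨j, hj, hjz⟩ := Finset.exists_ne_zero_of_sum_ne_zero hz
    rcases eq_or_ne j i with rfl | hji
    · exact (lead_eq_coe_iff.mp hy).2 z hjz
    · exact (lead_lt_coe_iff.mp (hlt j hj hji) z hjz).le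

theorem lead_add_lt (hu : P.lead u < y) (hv : P.lead v < y) : P.lead (u + v) < y := by
  refine lead_lt_coe_iff.mpr fun z hz => ?_
  rw [map_add, Finsupp.add_apply] at hz
  by_cases huz : P.coord u z = 0
  · exact lead_lt_coe_iff.mp hv z fun hvz => hz (by rw [huz, hvz, add_zero])
  · exact lead_lt_coe_iff.mp hu z huz

theorem lead_sub_eq (hu : P.lead u = y) (hv : P.lead v < y) : P.lead (u - v) = y := by
  have hcoord : ∀ z, P.coord (u - v) z = P.coord u z - P.coord v z := fun z => by
    rw [map_sub, Finsupp.sub_apply]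
  refine lead_eq_coe_iff.mpr ⟨?_, fun z hz => ?_⟩
  · have hvy : P.coord v y = 0 := by
      by_contra hne
      exact lt_irrefl y (lead_lt_coe_iff.mp hv y hne)
    rw [hcoord, hvy, sub_zero]
    exact coord_ne_zero_of_lead_eq hu
  · rw [hcoord] at hz
    by_cases huz : P.coord u z = 0
    · exact (lead_lt_coe_iff.mp hv z fun hvz => hz (by rw [huz, hvz, sub_zero])).le
    · exact (lead_eq_coe_iff.mp hu).2 z huz

theorem lead_monomial_smul (hu : P.lead u = y) {c : k} (hc : c ≠ 0) (a : σ →₀ ℕ) :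
    P.lead (monomial a c • u) = P.act a y := by
  have hinj := (P.act_strictMono a).injective
  obtain ⟨hy, hle⟩ := lead_eq_coe_iff.mp hu
  rw [lead_eq_coe_iff, P.coord_monomial_smul]
  refine ⟨?_, fun z hz => ?_⟩
  · rw [Finsupp.smul_apply, Finsupp.mapDomain_apply hinj]
    exact mul_ne_zero hc hy
  · rw [Finsupp.smul_apply] at hz
    have hrange : z ∈ Set.range (P.act a) := by
      by_contra hz'
      exact hz (by rw [Finsupp.mapDomain_of_notMem_range _ _ hz', smul_zero])
    obtain ⟨w, rfl⟩ := hrange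
    rw [Finsupp.mapDomain_apply hinj] at hz
    exact (P.act_strictMono a).monotone (hle w (right_ne_zero_of_mul hz))

variable (P) in
theorem act_zero (y : X) : P.act 0 y = y :=
  (P.act_strictMono 0).injective (by rw [← P.act_add, add_zero])

variable (P) in
theorem coord_C_smul (c : k) (u : U) : P.coord ((C c : MvPolynomial σ k) • u) = c • P.coord u := by
  rw [C_apply, P.coord_monomial_smul, funext P.act_zero]
  exact congrArg (c • ·) Finsupp.mapDomain_id

theorem exists_lead_sub_lt (hu : P.lead u = y) (hv : P.lead v = y) :
    ∃ c : k, P.lead (u - (C c : MvPolynomial σ k) • v) < y := by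
  obtain ⟨-, hule⟩ := lead_eq_coe_iff.mp hu
  obtain ⟨hvy, hvle⟩ := lead_eq_coe_iff.mp hv
  refine ⟨P.coord u y / P.coord v y, lead_lt_coe_iff.mpr fun z hz => ?_⟩
  rw [map_sub, coord_C_smul, Finsupp.sub_apply, Finsupp.smul_apply, smul_eq_mul] at hz
  refine lt_of_le_of_ne ?_ ?_
  · by_cases huz : P.coord u z = 0
    · exact hvle z fun hvz => hz (by rw [huz, hvz, mul_zero, sub_zero])
    · exact hule z huz
  · rintro rfl
    exact hz (by rw [div_mul_cancel₀ _ hvy, sub_self])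

variable (P) in
/-- The restriction of coordinates to a submodule. -/
noncomputable def restrict (K : Submodule (MvPolynomial σ k) U) : MonomialCoords σ k X K where
  act := P.act
  act_add := P.act_add
  act_strictMono := P.act_strictMono
  act_injective := P.act_injective
  coord := P.coord.comp K.subtype.toAddMonoidHom
  coord_injective := P.coord_injective.comp Subtype.val_injective
  coord_monomial_smul a c u := P.coord_monomial_smul a c u

end MonomialCoords

theorem repr_basisMonomials_apply {σ k : Type*} [Field k] (f : MvPolynomial σ k) (a : σ →₀ ℕ) :
    (basisMonomials σ k).repr f a = coeff a f := rfl

theorem repr_basisMonomials_monomial {σ k : Type*} [Field k] (a : σ →₀ ℕ) (c : k) :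
    (basisMonomials σ k).repr (monomial a c) = Finsupp.single a c := rfl

theorem repr_basisMonomials_monomial_mul {σ k : Type*} [Field k] (a : σ →₀ ℕ) (c : k)
    (f : MvPolynomial σ k) :
    (basisMonomials σ k).repr (monomial a c * f) =
      c • ((basisMonomials σ k).repr f).mapDomain (a + ·) := by
  induction f using MvPolynomial.induction_on' with
  | monomial d e =>
    rw [monomial_mul, repr_basisMonomials_monomial, repr_basisMonomials_monomial,
      Finsupp.mapDomain_single, Finsupp.smul_single, smul_eq_mul]
  | add f g hf hg =>
    rw [mul_add, map_add, hf, hg, map_add, Finsupp.mapDomain_add, smul_add]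

/-- The exponent vectors, linearly ordered by a monomial order. Unlike `ord.syn`, this type lives in
the universe of the variables. -/
def OrderedExponents {σ : Type*} (_ord : MonomialOrder σ) : Type _ := σ →₀ ℕ

/-- The identity map to the type `OrderedExponents ord`, which changes the order. -/
def toOrderedExponents {σ : Type*} (ord : MonomialOrder σ) (a : σ →₀ ℕ) : OrderedExponents ord := a

noncomputable instance {σ : Type*} (ord : MonomialOrder σ) : LinearOrder (OrderedExponents ord) :=
  LinearOrder.lift' (fun a : σ →₀ ℕ => ord.toSyn a) ord.toSyn.injective

instance {σ : Type*} (ord : MonomialOrder σ) : WellFoundedLT (OrderedExponents ord) :=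
  ⟨InvImage.wf (fun a : σ →₀ ℕ => ord.toSyn a) wellFounded_lt⟩

/-- The coordinates of polynomials given by their coefficients, with the exponent vectors ordered
by a monomial order. -/
noncomputable def polynomialCoords {σ : Type*} (k : Type*) [Field k] (ord : MonomialOrder σ) :
    MonomialCoords σ k (OrderedExponents ord) (MvPolynomial σ k) where
  act a (c : σ →₀ ℕ) := (a + c : σ →₀ ℕ)
  act_add := add_assoc (G := σ →₀ ℕ)
  act_strictMono a (c d : σ →₀ ℕ) hcd := by
    change ord.toSyn (a + c) < ord.toSyn (a + d)
    rw [map_add, map_add]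
    exact add_right_strictMono hcd
  act_injective := add_left_injective (G := σ →₀ ℕ)
  coord := (basisMonomials σ k).repr.toAddEquiv.toAddMonoidHom
  coord_injective := (basisMonomials σ k).repr.injective
  coord_monomial_smul := repr_basisMonomials_monomial_mul

theorem lead_polynomialCoords {σ k : Type*} [Field k] (ord : MonomialOrder σ)
    {f : MvPolynomial σ k} (hf : f ≠ 0) :
    (polynomialCoords k ord).lead f = toOrderedExponents ord (ord.degree f) := by
  rw [MonomialCoords.lead_eq_coe_iff]
  refine ⟨MonomialOrder.coeff_degree_ne_zero_iff.mpr hf, fun a (ha : coeff a f ≠ 0) => ?_⟩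
  exact MonomialOrder.le_degree (mem_support_iff.mpr ha)

theorem eq_and_eq_of_coeff_single_monomial_ne_zero {σ k ι : Type*} [Field k] [DecidableEq ι]
    {i j : ι} {a d : σ →₀ ℕ} {c : k}
    (h : coeff d ((Pi.single i (monomial a c) : ι → MvPolynomial σ k) j) ≠ 0) :
    j = i ∧ d = a := by
  classical
  rcases eq_or_ne j i with rfl | hji
  · rw [Pi.single_eq_same, coeff_monomial, ite_ne_right_iff] at h
    exact ⟨rfl, h.1.symm⟩
  · rw [Pi.single_eq_of_ne hji, coeff_zero] at h
    exact absurd rfl h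

section FreeModules

variable {σ k X U ι : Type*} [Field k] [LinearOrder X] [AddCommGroup U]
  [Module (MvPolynomial σ k) U] (P : MonomialCoords σ k X U) (x : ι → X)

/-- The position of the monomial `x^a` of the `i`-th coordinate of a free module whose `i`-th basis
vector has position `x i`; ties are broken by the index. -/
def basisPosition (i : ι) (a : σ →₀ ℕ) : X ×ₗ ι := toLex (P.act a (x i), i)

variable {P x}

theorem basisPosition_inj {i j : ι} {a c : σ →₀ ℕ} :
    basisPosition P x i a = basisPosition P x j c ↔ i = j ∧ a = c := by
  constructor
  · intro h
    obtain rfl : i = j := congrArg (fun p => (ofLex p).2) h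
    exact ⟨rfl, P.act_injective (x i) (congrArg (fun p => (ofLex p).1) h)⟩
  · rintro ⟨rfl, rfl⟩
    rfl

theorem basisPosition_injective (i : ι) : Function.Injective (basisPosition P x i) := fun _ _ h =>
  (basisPosition_inj.mp h).2

section Coord

variable [Fintype ι]

variable (P x) in
/-- The coordinates of the elements of a free module with basis vectors in positions `x i`. -/
noncomputable def freeCoord : (ι → MvPolynomial σ k) →+ (X ×ₗ ι →₀ k) where
  toFun h := ∑ i, ((basisMonomials σ k).repr (h i)).mapDomain (basisPosition P x i)
  map_zero' := by simp
  map_add' h h' := by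
    simp only [Pi.add_apply, map_add, Finsupp.mapDomain_add, Finset.sum_add_distrib]

theorem freeCoord_apply (h : ι → MvPolynomial σ k) :
    freeCoord P x h = ∑ i, ((basisMonomials σ k).repr (h i)).mapDomain (basisPosition P x i) :=
  rfl

theorem freeCoord_basisPosition (h : ι → MvPolynomial σ k) (i : ι) (a : σ →₀ ℕ) :
    freeCoord P x h (basisPosition P x i a) = coeff a (h i) := by
  rw [freeCoord_apply, Finsupp.finsetSum_apply,
    Finset.sum_eq_single_of_mem i (Finset.mem_univ i) fun j _ hji => ?_,
    Finsupp.mapDomain_apply (basisPosition_injective i), repr_basisMonomials_apply]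
  refine Finsupp.mapDomain_of_notMem_range _ _ ?_
  rintro ⟨c, hc⟩
  exact hji (basisPosition_inj.mp hc).1

theorem exists_eq_basisPosition_of_freeCoord_ne_zero {h : ι → MvPolynomial σ k} {y : X ×ₗ ι}
    (hy : freeCoord P x h y ≠ 0) : ∃ i a, y = basisPosition P x i a := by
  rw [freeCoord_apply, Finsupp.finsetSum_apply] at hy
  obtain ⟨i, -, hi⟩ := Finset.exists_ne_zero_of_sum_ne_zero hy
  by_contra! hne
  refine hi (Finsupp.mapDomain_of_notMem_range _ _ ?_)
  rintro ⟨a, rfl⟩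
  exact hne i a rfl

theorem freeCoord_injective : Function.Injective (freeCoord P x) := fun h h' heq => by
  funext i
  ext a
  rw [← freeCoord_basisPosition (P := P) (x := x), heq, freeCoord_basisPosition]

end Coord

variable [LinearOrder ι]

theorem basisPosition_lt_iff {i j : ι} {a c : σ →₀ ℕ} :
    basisPosition P x i a < basisPosition P x j c ↔
      P.act a (x i) < P.act c (x j) ∨ P.act a (x i) = P.act c (x j) ∧ i < j :=
  Prod.Lex.lt_iff

variable [Fintype ι]

variable (P x) in
/-- The coordinates of a free module with basis vectors in positions `x i`. -/
noncomputable def freeCoords : MonomialCoords σ k (X ×ₗ ι) (ι → MvPolynomial σ k) where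
  act a y := toLex (P.act a (ofLex y).1, (ofLex y).2)
  act_add a c y := congrArg (fun z => toLex (z, (ofLex y).2)) (P.act_add a c _)
  act_strictMono a y z hyz := by
    rw [Prod.Lex.lt_iff] at hyz ⊢
    exact hyz.imp (fun h => P.act_strictMono a h) (And.imp_left (congrArg (P.act a)))
  act_injective y a c h := P.act_injective (ofLex y).1 (congrArg (fun p => (ofLex p).1) h)
  coord := freeCoord P x
  coord_injective := freeCoord_injective
  coord_monomial_smul a c h := by
    rw [freeCoord_apply, freeCoord_apply, Finsupp.mapDomain_finsetSum, Finset.smul_sum]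
    refine Finset.sum_congr rfl fun i _ => ?_
    rw [Pi.smul_apply, smul_eq_mul, repr_basisMonomials_monomial_mul, Finsupp.mapDomain_smul,
      ← Finsupp.mapDomain_comp, ← Finsupp.mapDomain_comp]
    congr 2
    exact funext fun d => congrArg (fun z => toLex (z, i)) (P.act_add a d (x i))

theorem act_basisPosition (a c : σ →₀ ℕ) (i : ι) :
    (freeCoords P x).act a (basisPosition P x i c) = basisPosition P x i (a + c) :=
  congrArg (fun z => toLex (z, i)) (P.act_add a c (x i)).symm

theorem le_lead_freeCoords {h : ι → MvPolynomial σ k} {i : ι} {a : σ →₀ ℕ}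
    (ha : coeff a (h i) ≠ 0) : basisPosition P x i a ≤ (freeCoords P x).lead h :=
  MonomialCoords.le_lead (ne_of_eq_of_ne (freeCoord_basisPosition h i a) ha)

theorem exists_lead_freeCoords_eq {h : ι → MvPolynomial σ k} (hh : h ≠ 0) :
    ∃ i a, coeff a (h i) ≠ 0 ∧ (freeCoords P x).lead h = basisPosition P x i a := by
  obtain ⟨y, hy⟩ := MonomialCoords.exists_lead_eq_coe (P := freeCoords P x) hh
  have hne := MonomialCoords.coord_ne_zero_of_lead_eq hy
  obtain ⟨i, a, rfl⟩ := exists_eq_basisPosition_of_freeCoord_ne_zero hne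
  exact ⟨i, a, ne_of_eq_of_ne (freeCoord_basisPosition h i a).symm hne, hy⟩

theorem lead_freeCoords_lt {h : ι → MvPolynomial σ k} {y : X ×ₗ ι}
    (hlt : ∀ i a, coeff a (h i) ≠ 0 → basisPosition P x i a < y) :
    (freeCoords P x).lead h < y := by
  refine MonomialCoords.lead_lt_coe_iff.mpr fun z hz => ?_
  obtain ⟨i, a, rfl⟩ := exists_eq_basisPosition_of_freeCoord_ne_zero hz
  exact hlt i a (ne_of_eq_of_ne (freeCoord_basisPosition h i a).symm hz)

theorem lead_freeCoords_single {i : ι} {a : σ →₀ ℕ} :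
    (freeCoords P x).lead (Pi.single i (monomial a 1)) = basisPosition P x i a := by
  classical
  have hne : (Pi.single i (monomial a (1 : k)) : ι → MvPolynomial σ k) ≠ 0 := by
    simp
  obtain ⟨j, d, hd, hlead⟩ := exists_lead_freeCoords_eq (P := P) (x := x) hne
  obtain ⟨rfl, rfl⟩ := eq_and_eq_of_coeff_single_monomial_ne_zero hd
  exact hlead

end FreeModules

end LeadingPositions

section Syzygies

open MvPolynomial

/-- The leading positions of the elements of the module are generated by the positions `x i`, and
the positions generated by the `x j` with `j < i` meet those generated by `x i` in the multiples of
the variables of `Z i`, which number fewer than `s`. -/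
structure MonomialCoords.LinearQuotients {σ k X U : Type*} [Field k] [LinearOrder X]
    [AddCommGroup U] [Module (MvPolynomial σ k) U] (P : MonomialCoords σ k X U) {ι : Type*}
    [LinearOrder ι] (x : ι → X) (Z : ι → Finset σ) (s : ℕ) : Prop where
  exists_lead : ∀ i, ∃ u, P.lead u = x i
  exists_act : ∀ u ≠ 0, ∃ i a, P.lead u = P.act a (x i)
  colon_iff : ∀ i u, (∃ j < i, ∃ a, P.act u (x i) = P.act a (x j)) ↔ ∃ z ∈ Z i, u z ≠ 0
  card_lt : ∀ i, (Z i).card < s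

variable {σ k X U ι : Type*} [Field k] [LinearOrder X] [AddCommGroup U]
  [Module (MvPolynomial σ k) U] {P : MonomialCoords σ k X U} {x : ι → X} {g : ι → U}

theorem linearCombination_eq_sum_monomial_smul [Fintype ι] (h : ι → MvPolynomial σ k) :
    Fintype.linearCombination (MvPolynomial σ k) g h =
      ∑ p ∈ Finset.univ.sigma fun i => (h i).support, monomial p.2 (coeff p.2 (h p.1)) • g p.1 := by
  rw [Finset.sum_sigma, Fintype.linearCombination_apply]
  refine Finset.sum_congr rfl fun i _ => ?_
  conv_lhs => rw [← support_sum_monomial_coeff (h i), Finset.sum_smul]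

theorem lead_linearCombination_eq [Fintype ι] (hg : ∀ i, P.lead (g i) = x i)
    {h : ι → MvPolynomial σ k} {i : ι} {a : σ →₀ ℕ} (ha : coeff a (h i) ≠ 0)
    (hlt : ∀ j c, coeff c (h j) ≠ 0 → (j = i → c ≠ a) → P.act c (x j) < P.act a (x i)) :
    P.lead (Fintype.linearCombination (MvPolynomial σ k) g h) = P.act a (x i) := by
  rw [linearCombination_eq_sum_monomial_smul]
  refine MonomialCoords.lead_sum_eq (i := ⟨i, a⟩) ?_
    (MonomialCoords.lead_monomial_smul (hg i) ha a) ?_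
  · exact Finset.mem_sigma.mpr ⟨Finset.mem_univ i, mem_support_iff.mpr ha⟩
  · rintro ⟨j, c⟩ hjc hne
    have hc : coeff c (h j) ≠ 0 := mem_support_iff.mp (Finset.mem_sigma.mp hjc).2
    rw [MonomialCoords.lead_monomial_smul (hg j) hc c, WithBot.coe_lt_coe]
    refine hlt j c hc ?_
    rintro rfl rfl
    exact hne rfl

namespace MonomialCoords.LinearQuotients

variable [LinearOrder ι] [Fintype ι] {Z : ι → Finset σ} {s : ℕ}

theorem exists_representation [WellFoundedLT X] (hq : P.LinearQuotients x Z s)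
    (hg : ∀ i, P.lead (g i) = x i) (u : U) :
    ∃ h : ι → MvPolynomial σ k, Fintype.linearCombination (MvPolynomial σ k) g h = u ∧
      ∀ i a, coeff a (h i) ≠ 0 → P.act a (x i) ≤ P.lead u := by
  induction hl : P.lead u using WellFoundedLT.induction generalizing u with
  | ind y ih =>
  subst hl
  by_cases hu : u = 0
  · exact ⟨0, by rw [map_zero, hu], fun i a ha => absurd (coeff_zero a) ha⟩
  obtain ⟨i, a, hia⟩ := hq.exists_act u hu
  obtain ⟨c, hc⟩ := exists_lead_sub_lt hia (lead_monomial_smul (hg i) one_ne_zero a)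
  rw [← hia] at hc
  obtain ⟨h, hh, hle⟩ := ih _ hc _ rfl
  refine ⟨h + Pi.single i (monomial a c), ?_, fun j e hje => ?_⟩
  · rw [map_add, hh, Fintype.linearCombination_apply_single, smul_smul, C_mul_monomial, mul_one,
      sub_add_cancel]
  · by_cases hj : coeff e (h j) = 0
    · rw [Pi.add_apply, coeff_add, hj, zero_add] at hje
      obtain ⟨rfl, rfl⟩ := eq_and_eq_of_coeff_single_monomial_ne_zero hje
      exact hia.ge
    · exact (hle j e hj).trans hc.le

/-- Otherwise the leading position of `h` cannot cancel in the sum `∑ i, h i • g i = 0`. -/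
theorem exists_mem_of_lead_syzygy (hq : P.LinearQuotients x Z s) (hg : ∀ i, P.lead (g i) = x i)
    {h : ι → MvPolynomial σ k} (hker : Fintype.linearCombination (MvPolynomial σ k) g h = 0)
    {i : ι} {a : σ →₀ ℕ} (ha : coeff a (h i) ≠ 0)
    (hlead : (freeCoords P x).lead h = basisPosition P x i a) : ∃ z ∈ Z i, a z ≠ 0 := by
  by_contra hne
  rw [← hq.colon_iff] at hne
  refine WithBot.coe_ne_bot ((lead_linearCombination_eq hg ha fun j c hc hjc => ?_).symm.trans
    (lead_eq_bot_iff.mpr hker))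
  have hle : basisPosition P x j c ≤ basisPosition P x i a :=
    WithBot.coe_le_coe.mp (hlead ▸ le_lead_freeCoords hc)
  rcases hle.lt_or_eq with hlt | heq
  · refine (basisPosition_lt_iff.mp hlt).resolve_right ?_
    rintro ⟨hact, hji⟩
    exact hne ⟨j, hji, c, hact.symm⟩
  · obtain ⟨hji, hca⟩ := basisPosition_inj.mp heq
    exact absurd hca (hjc hji)

theorem exists_syzygy [WellFoundedLT X] (hq : P.LinearQuotients x Z s)
    (hg : ∀ i, P.lead (g i) = x i) {i : ι} {z : σ} (hz : z ∈ Z i) :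
    ∃ h : ι → MvPolynomial σ k, Fintype.linearCombination (MvPolynomial σ k) g h = 0 ∧
      (freeCoords P x).lead h = basisPosition P x i (Finsupp.single z 1) := by
  obtain ⟨j, hji, a, ha⟩ := (hq.colon_iff i (Finsupp.single z 1)).mpr
    ⟨z, hz, by rw [Finsupp.single_eq_same]; exact one_ne_zero⟩
  have hi := lead_monomial_smul (hg i) (one_ne_zero (α := k)) (Finsupp.single z 1)
  have hj := lead_monomial_smul (hg j) (one_ne_zero (α := k)) a
  obtain ⟨c, hc⟩ := exists_lead_sub_lt hi (hj.trans (congrArg _ ha.symm))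
  obtain ⟨h, hh, hle⟩ := hq.exists_representation hg
    (monomial (Finsupp.single z 1) (1 : k) • g i -
      (C c : MvPolynomial σ k) • monomial a (1 : k) • g j)
  have hlt_single : (freeCoords P x).lead (Pi.single j (monomial a c)) <
      basisPosition P x i (Finsupp.single z 1) := by
    refine lead_freeCoords_lt fun l e hl => ?_
    obtain ⟨rfl, rfl⟩ := eq_and_eq_of_coeff_single_monomial_ne_zero hl
    exact basisPosition_lt_iff.mpr (.inr ⟨ha.symm, hji⟩)
  have hlt : (freeCoords P x).lead h < basisPosition P x i (Finsupp.single z 1) :=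
    lead_freeCoords_lt fun l e hl =>
      basisPosition_lt_iff.mpr (.inl (WithBot.coe_lt_coe.mp ((hle l e hl).trans_lt hc)))
  refine ⟨_, ?_, lead_sub_eq lead_freeCoords_single (lead_add_lt hlt_single hlt)⟩
  rw [map_sub, map_add, hh, Fintype.linearCombination_apply_single,
    Fintype.linearCombination_apply_single, smul_smul, C_mul_monomial, mul_one, add_sub_cancel,
    sub_self]

end MonomialCoords.LinearQuotients

/-- The pairs of an index `i` and a variable of `Z i`, which index generators of the syzygies of a
family with linear quotients. -/
abbrev SyzygyIndex (Z : ι → Finset σ) : Type _ :=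
  {p : ι ×ₗ σ // (ofLex p).2 ∈ Z (ofLex p).1}

/-- The leading position of the syzygy with index `p`. -/
noncomputable def syzygyPosition (P : MonomialCoords σ k X U) (x : ι → X) {Z : ι → Finset σ}
    (p : SyzygyIndex Z) : X ×ₗ ι :=
  basisPosition P x (ofLex p.1).1 (Finsupp.single (ofLex p.1).2 1)

theorem exists_lt_act_syzygyPosition_iff [LinearOrder ι] [Fintype ι] [LinearOrder σ]
    {Z : ι → Finset σ} (p : SyzygyIndex Z) (u : σ →₀ ℕ) :
    (∃ p' < p, ∃ a, (freeCoords P x).act u (syzygyPosition P x p) =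
      (freeCoords P x).act a (syzygyPosition P x p')) ↔
      ∃ w ∈ (Z (ofLex p.1).1).filter (· < (ofLex p.1).2), u w ≠ 0 := by
  simp only [syzygyPosition, act_basisPosition, basisPosition_inj]
  constructor
  · rintro ⟨p', hlt, a, hindex, ha⟩
    have hw : (ofLex p'.1).2 < (ofLex p.1).2 :=
      ((Prod.Lex.lt_iff.mp hlt).resolve_left hindex.le.not_gt).2
    refine ⟨(ofLex p'.1).2, Finset.mem_filter.mpr ⟨hindex ▸ p'.2, hw⟩, ?_⟩
    have huw := DFunLike.congr_fun ha (ofLex p'.1).2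
    rw [Finsupp.add_apply, Finsupp.add_apply, Finsupp.single_eq_same,
      Finsupp.single_eq_of_ne hw.ne] at huw
    omega
  · rintro ⟨w, hw, huw⟩
    obtain ⟨hwZ, hwlt⟩ := Finset.mem_filter.mp hw
    refine ⟨⟨toLex ((ofLex p.1).1, w), hwZ⟩, Prod.Lex.lt_iff.mpr (.inr ⟨rfl, hwlt⟩),
      u - Finsupp.single w 1 + Finsupp.single (ofLex p.1).2 1, rfl, ?_⟩
    rw [ofLex_toLex, add_right_comm, tsub_add_cancel_of_le (single_one_le_of_ne_zero huw)]

theorem MonomialCoords.LinearQuotients.syzygies [LinearOrder ι] [Fintype ι] [LinearOrder σ]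
    [WellFoundedLT X] {Z : ι → Finset σ} {s : ℕ} (hq : P.LinearQuotients x Z (s + 1))
    (hg : ∀ i, P.lead (g i) = x i) :
    ((freeCoords P x).restrict
      (LinearMap.ker (Fintype.linearCombination (MvPolynomial σ k) g))).LinearQuotients
      (fun p : SyzygyIndex Z => syzygyPosition P x p)
      (fun p => (Z (ofLex p.1).1).filter (· < (ofLex p.1).2)) s where
  exists_lead := by
    rintro ⟨p, hp⟩
    obtain ⟨h, hker, hlead⟩ := hq.exists_syzygy hg hp
    exact ⟨⟨h, hker⟩, hlead⟩
  exists_act := by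
    rintro ⟨h, hker⟩ hne
    obtain ⟨i, a, ha, hlead⟩ :=
      exists_lead_freeCoords_eq (P := P) (x := x) fun h0 => hne (Subtype.ext h0)
    obtain ⟨z, hz, haz⟩ := hq.exists_mem_of_lead_syzygy hg hker ha hlead
    refine ⟨⟨toLex (i, z), hz⟩, a - Finsupp.single z 1, hlead.trans (congrArg _ ?_)⟩
    refine Eq.trans ?_ (act_basisPosition (a - Finsupp.single z 1) (Finsupp.single z 1) i).symm
    rw [tsub_add_cancel_of_le (single_one_le_of_ne_zero haz)]
  colon_iff := exists_lt_act_syzygyPosition_iff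
  card_lt := by
    rintro ⟨p, hp⟩
    refine Nat.lt_of_lt_of_le (Finset.card_lt_card ?_) (Nat.lt_succ_iff.mp (hq.card_lt (ofLex p).1))
    exact Finset.filter_ssubset.mpr ⟨_, hp, lt_irrefl _⟩

end Syzygies

section Ext

open CategoryTheory Abelian MvPolynomial

universe u v

theorem subsingleton_ext_pi {R : Type u} [CommRing R] (N : ModuleCat.{max u v} R) (d : ℕ)
    (M : Type (max u v)) [AddCommGroup M] [Module R M]
    (hM : Subsingleton (Ext N (ModuleCat.of R M) d)) (ι : Type v) [Finite ι] :
    Subsingleton (Ext N (ModuleCat.of R (ι → M)) d) := by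
  classical
  have := Fintype.ofFinite ι
  refine subsingleton_of_forall_eq 0 fun y => ?_
  have hid : 𝟙 (ModuleCat.of R (ι → M)) = ∑ i, ModuleCat.ofHom (LinearMap.proj i) ≫
      ModuleCat.ofHom (LinearMap.single R (fun _ : ι => M) i) := by
    refine ModuleCat.hom_ext (LinearMap.ext fun v => ?_)
    rw [ModuleCat.hom_sum, LinearMap.sum_apply]
    exact (Finset.univ_sum_single v).symm
  rw [← Ext.comp_mk₀_id y, hid, Ext.mk₀_sum, Ext.comp_sum]
  refine Finset.sum_eq_zero fun i _ => ?_
  rw [← Ext.mk₀_comp_mk₀, ← Ext.comp_assoc_of_third_deg_zero,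
    Subsingleton.elim (y.comp (Ext.mk₀ (ModuleCat.ofHom (LinearMap.proj i))) (add_zero d)) 0,
    Ext.zero_comp]

theorem subsingleton_ext_of_surjective {R : Type u} [CommRing R] (N : ModuleCat.{u} R) (d : ℕ)
    {M P : Type u} [AddCommGroup M] [Module R M] [AddCommGroup P] [Module R P] {f : M →ₗ[R] P}
    (hf : Function.Surjective f) (hM : Subsingleton (Ext N (ModuleCat.of R M) d))
    (hK : Subsingleton (Ext N (ModuleCat.of R (LinearMap.ker f)) (d + 1))) :
    Subsingleton (Ext N (ModuleCat.of R P) d) := by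
  refine subsingleton_of_forall_eq 0 fun y => ?_
  obtain ⟨z, hz⟩ := Ext.covariant_sequence_exact₃ N (LinearMap.shortExact_shortComplexKer hf) y rfl
    (hK.elim _ _)
  rw [← hz, hM.elim z 0, Ext.zero_comp]

theorem subsingleton_ext_of_subsingleton {R : Type u} [CommRing R] (N : ModuleCat.{u} R) (d : ℕ)
    (M : Type u) [AddCommGroup M] [Module R M] [Subsingleton M] :
    Subsingleton (Ext N (ModuleCat.of R M) d) := by
  have hzero := ModuleCat.isZero_of_subsingleton (ModuleCat.of R M)
  refine subsingleton_of_forall_eq 0 fun y => ?_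
  rw [← Ext.comp_mk₀_id y, hzero.eq_of_src (𝟙 _) 0, Ext.mk₀_zero, Ext.comp_zero]

theorem MonomialCoords.LinearQuotients.subsingleton_ext {k : Type u} [Field k] {σ : Type v}
    [LinearOrder σ] [Finite σ] (N : ModuleCat.{max u v} (MvPolynomial σ k)) {n : ℕ}
    (hR : ∀ d < n, Subsingleton (Ext N (ModuleCat.of _ (MvPolynomial σ k)) d))
    {s : ℕ} {X : Type v} [LinearOrder X] [WellFoundedLT X] {U : Type (max u v)} [AddCommGroup U]
    [Module (MvPolynomial σ k) U] {P : MonomialCoords σ k X U} {ι : Type v} [LinearOrder ι]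
    [Finite ι] {x : ι → X} {Z : ι → Finset σ} (hq : P.LinearQuotients x Z s) {d : ℕ}
    (hd : d + s ≤ n) : Subsingleton (Ext N (ModuleCat.of (MvPolynomial σ k) U) d) := by
  induction s generalizing X U ι d with
  | zero =>
    have : Subsingleton U := subsingleton_of_forall_eq 0 fun u => by
      by_contra hu
      obtain ⟨i, -⟩ := hq.exists_act u hu
      exact absurd (hq.card_lt i) (Nat.not_lt_zero _)
    exact subsingleton_ext_of_subsingleton N d U
  | succ s ih =>
    have := Fintype.ofFinite ι
    have : Finite (ι ×ₗ σ) := inferInstanceAs (Finite (ι × σ))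
    choose g hg using hq.exists_lead
    have hsurj : Function.Surjective (Fintype.linearCombination (MvPolynomial σ k) g) := fun u =>
      (hq.exists_representation hg u).imp fun _ h => h.1
    exact subsingleton_ext_of_surjective N d hsurj
      (subsingleton_ext_pi N d _ (hR d (by omega)) ι) (ih (hq.syzygies hg) (by omega))

end Ext

section RegularSequences

open RingTheory.Sequence

/-- Every maximal ideal contains a weakly regular sequence of length `n`. -/
def HasRegularSequences (R : Type*) [CommRing R] (n : ℕ) : Prop :=
  ∀ m : Ideal R, m.IsMaximal → ∃ rs : List R, rs.length = n ∧ (∀ r ∈ rs, r ∈ m) ∧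
    IsWeaklyRegular R rs

theorem HasRegularSequences.of_ringEquiv {R R' : Type*} [CommRing R] [CommRing R'] {n : ℕ}
    (h : HasRegularSequences R n) (e : R ≃+* R') : HasRegularSequences R' n := by
  intro m hm
  obtain ⟨rs, hlen, hmem, hreg⟩ := h (m.comap e) (Ideal.comap_isMaximal_of_equiv e)
  refine ⟨rs.map e, List.length_map e |>.trans hlen, List.forall_mem_map.mpr hmem, ?_⟩
  refine (AddEquiv.isWeaklyRegular_congr (e := e.toAddEquiv) ?_).mp hreg
  exact List.forall₂_map_right_iff.mpr (List.forall₂_same.mpr fun r _ => map_mul e r)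

theorem isSMulRegular_quotient_map_C {R : Type*} [CommRing R] (Q : Ideal R) {p : Polynomial R}
    (hp : p.Monic) : IsSMulRegular (Polynomial R ⧸ Q.map Polynomial.C) p := by
  have hmem : ∀ g : Polynomial R,
      g ∈ Q.map Polynomial.C ↔ g.map (Ideal.Quotient.mk Q) = 0 := fun g => by
    rw [← Polynomial.coe_mapRingHom, ← RingHom.mem_ker, Polynomial.ker_mapRingHom, Ideal.mk_ker]
  refine (isSMulRegular_quotient_iff_mem_of_smul_mem _ _).mpr fun f hf => ?_
  rw [hmem, smul_eq_mul, Polynomial.map_mul, (hp.map _).mul_right_eq_zero_iff] at hf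
  exact (hmem f).mpr hf

theorem exists_monic_mem_of_isMaximal {R : Type*} [CommRing R] [IsJacobsonRing R]
    (m : Ideal (Polynomial R)) [m.IsMaximal] : ∃ p : Polynomial R, p.Monic ∧ p ∈ m := by
  obtain ⟨p, hp, hpm⟩ := Polynomial.quotient_mk_comp_C_isIntegral_of_isJacobsonRing m
    (Ideal.Quotient.mk m Polynomial.X)
  refine ⟨p, hp, ?_⟩
  rw [← Ideal.Quotient.eq_zero_iff_mem, ← hpm, ← Polynomial.hom_eval₂, Polynomial.eval₂_C_X]

theorem HasRegularSequences.polynomial {R : Type*} [CommRing R] [IsJacobsonRing R] {n : ℕ}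
    (h : HasRegularSequences R n) : HasRegularSequences (Polynomial R) (n + 1) := by
  intro m hm
  obtain ⟨rs, hlen, hmem, hreg⟩ := h (m.comap Polynomial.C)
    (Polynomial.isMaximal_comap_C_of_isJacobsonRing m)
  obtain ⟨p, hp, hpm⟩ := exists_monic_mem_of_isMaximal m
  refine ⟨rs.map Polynomial.C ++ [p], by simp [hlen], ?_, ?_⟩
  · exact List.forall_mem_append.mpr
      ⟨List.forall_mem_map.mpr hmem, List.forall_mem_singleton.mpr hpm⟩
  · rw [isWeaklyRegular_append_iff]
    refine ⟨hreg.of_flat, ?_⟩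
    rw [isWeaklyRegular_singleton_iff, ← Ideal.map_ofList, smul_eq_mul, Ideal.mul_top]
    exact isSMulRegular_quotient_map_C _ hp

theorem hasRegularSequences_mvPolynomial_fin (k : Type*) [Field k] (n : ℕ) :
    HasRegularSequences (MvPolynomial (Fin n) k) n := by
  induction n with
  | zero => exact fun _ _ => ⟨[], rfl, List.forall_mem_nil _, .nil _ _⟩
  | succ n ih => exact ih.polynomial.of_ringEquiv (MvPolynomial.finSuccEquiv k n).symm.toRingEquiv

theorem hasRegularSequences_mvPolynomial (σ k : Type*) [Finite σ] [Field k] :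
    HasRegularSequences (MvPolynomial σ k) (Nat.card σ) :=
  (hasRegularSequences_mvPolynomial_fin k (Nat.card σ)).of_ringEquiv
    (MvPolynomial.renameEquiv k (Finite.equivFin σ).symm).toRingEquiv

open CategoryTheory Abelian in
theorem HasRegularSequences.subsingleton_ext {R : Type*} [CommRing R] [IsNoetherianRing R] {n : ℕ}
    (h : HasRegularSequences R n) (m : Ideal R) (hm : m.IsMaximal) {d : ℕ} (hd : d < n) :
    Subsingleton (Ext (ModuleCat.of R (R ⧸ m)) (ModuleCat.of R R) d) := by
  obtain ⟨rs, hlen, hmem, hreg⟩ := h m hm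
  have hmt : m • (⊤ : Ideal R) ≠ ⊤ := by
    rw [smul_eq_mul, Ideal.mul_top]
    exact hm.ne_top
  refine ModuleCat.subsingleton_ext_of_exists_isRegular m _ ?_ (ModuleCat.of _ _) hmt.lt_top rs
    hmem ⟨hreg, fun htop => hmt (top_le_iff.mp (htop.le.trans ?_))⟩ d (by omega)
  · rw [Module.support_eq_zeroLocus, Ideal.annihilator_quotient]
  · exact Submodule.smul_mono_left (Ideal.span_le.mpr hmem)

end RegularSequences

section Depth

open MvPolynomial

universe v

theorem HasLinearQuotients.exists_enumeration {σ : Type*} {A : Finset σ} {s : ℕ}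
    {L : Set (σ →₀ ℕ)} (h : HasLinearQuotients A s L) :
    ∃ (ι : Type v) (_ : LinearOrder ι) (_ : Finite ι) (x : ι → σ →₀ ℕ) (Z : ι → Finset σ),
      (∀ i, (Z i).card < s) ∧ (∀ a, a ∈ L ↔ ∃ i, x i ≤ a) ∧
      ∀ i u, (∃ j < i, x j ≤ x i + u) ↔ ∃ z ∈ Z i, u z ≠ 0 := by
  induction h with
  | empty =>
    exact ⟨PEmpty, inferInstance, inferInstance, PEmpty.elim, PEmpty.elim, by simp, by simp,
      by simp⟩
  | @union_Ici L a Z _ _ hZ h ih =>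
    obtain ⟨ι, _, _, x, Y, hY, hx, hcolon⟩ := ih
    have : Finite (WithTop ι) := inferInstanceAs (Finite (Option ι))
    refine ⟨WithTop ι, inferInstance, this, WithTop.recTopCoe a x, WithTop.recTopCoe Z Y,
      ?_, fun c => ?_, WithTop.forall.mpr ⟨fun u => ?_, fun i u => ?_⟩⟩
    · exact WithTop.forall.mpr ⟨hZ, hY⟩
    · simp [WithTop.exists, hx, or_comm]
    · simp [WithTop.exists, ← h, hx]
    · simpa [WithTop.exists] using hcolon i u

theorem MonomialCoords.exists_linearQuotients_restrict {σ k : Type*} [Field k]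
    {ord : MonomialOrder σ} {I : Ideal (MvPolynomial σ k)} {A : Finset σ} {s : ℕ}
    (h : HasLinearQuotients A s (exponents (ini ord I))) :
    ∃ (ι : Type v) (_ : LinearOrder ι) (_ : Finite ι) (x : ι → OrderedExponents ord)
      (Z : ι → Finset σ),
      ((polynomialCoords k ord).restrict I).LinearQuotients x Z s := by
  obtain ⟨ι, _, _, x, Z, hZ, hx, hcolon⟩ := h.exists_enumeration
  refine ⟨ι, _, ‹_›, fun i => toOrderedExponents ord (x i), Z, ⟨fun i => ?_, ?_, fun i u => ?_, hZ⟩⟩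
  · obtain ⟨f, hf, hf0, hdeg⟩ := mem_exponents_ini_iff.mp ((hx (x i)).mpr ⟨i, le_rfl⟩)
    exact ⟨⟨f, hf⟩, hdeg ▸ lead_polynomialCoords ord hf0⟩
  · rintro ⟨f, hf⟩ hne
    have hf0 : f ≠ 0 := fun h0 => hne (Subtype.ext h0)
    obtain ⟨i, hi⟩ := (hx (ord.degree f)).mp (mem_exponents_ini_iff.mpr ⟨f, hf, hf0, rfl⟩)
    refine ⟨i, ord.degree f - x i, (lead_polynomialCoords ord hf0).trans (congrArg _ ?_)⟩
    exact congrArg (toOrderedExponents ord) (tsub_add_cancel_of_le hi).symm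
  · rw [← hcolon i u]
    refine exists_congr fun j => and_congr_right fun _ => ?_
    change (∃ a, u + x i = a + x j) ↔ _
    rw [le_iff_exists_add', add_comm u]

theorem le_depth_of_hasLinearQuotients {σ k : Type*} [Finite σ] [Field k]
    {I : Ideal (MvPolynomial σ k)} {ord : MonomialOrder σ} {A : Finset σ} {s q : ℕ}
    (hs : s + q ≤ Nat.card σ) (h : HasLinearQuotients A s (exponents (ini ord I))) :
    (q : ℕ∞) ≤ depth (MvPolynomial σ k) (MvPolynomial σ k ⧸ I) := by
  classical
  refine le_iInf fun m => le_iInf₂ fun d hd => ?_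
  by_contra hlt
  rw [not_le, Nat.cast_lt] at hlt
  let _ : LinearOrder σ := linearOrderOfSTO WellOrderingRel
  obtain ⟨ι, _, _, x, Z, hq⟩ := MonomialCoords.exists_linearQuotients_restrict h
  have hR := fun (e : ℕ) (he : e < Nat.card σ) =>
    (hasRegularSequences_mvPolynomial σ k).subsingleton_ext m.asIdeal m.isMaximal he
  refine not_nontrivial_iff_subsingleton.mpr ?_ hd
  refine subsingleton_ext_of_surjective _ d (Submodule.mkQ_surjective I) (hR d (by omega)) ?_
  rw [Submodule.ker_mkQ]
  have hds : d + 1 + s ≤ Nat.card σ := by omega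
  exact hq.subsingleton_ext _ hR hds

end Depth

section VarGroups

variable {σ k : Type*} [Field k] {q : ℕ} {t : Fin q → ℕ} {b : (i : Fin q) → Fin (t i + 1) → σ}

/-- The group `{b i 0, …, b i (t i)}` of variables, whose sum is the linear form `f i`. -/
def varGroup (hb : Function.Injective fun p : (i : Fin q) × Fin (t i + 1) => b p.1 p.2)
    (i : Fin q) : Finset σ :=
  Finset.univ.map ⟨b i, hb.comp sigma_mk_injective⟩

variable (hb : Function.Injective fun p : (i : Fin q) × Fin (t i + 1) => b p.1 p.2)

theorem mem_varGroup {i : Fin q} {y : σ} : y ∈ varGroup hb i ↔ ∃ j, b i j = y := by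
  simp [varGroup]

theorem sum_varGroup {M : Type*} [AddCommMonoid M] (f : σ → M) (i : Fin q) :
    ∑ y ∈ varGroup hb i, f y = ∑ j, f (b i j) :=
  Finset.sum_map _ _ _

theorem pairwise_disjoint_varGroup :
    Pairwise fun i j => Disjoint (varGroup hb i) (varGroup hb j) := by
  intro i i' hne
  refine Finset.disjoint_left.mpr fun y hy hy' => hne ?_
  obtain ⟨j, rfl⟩ := (mem_varGroup hb).mp hy
  obtain ⟨j', hj'⟩ := (mem_varGroup hb).mp hy'
  exact (congrArg Sigma.fst (hb (a₁ := ⟨i', j'⟩) (a₂ := ⟨i, j⟩) hj')).symm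

theorem adapted_varGroup {J : Ideal (MvPolynomial σ k)} (i : Fin q)
    (h₁ : ∀ j, j ≠ 0 → varDegree (b i j) J ≤ 1)
    (h₂ : ∀ a ∈ minGens J, a (b i 0) ≠ 0 → ∃ j, j ≠ 0 ∧ a (b i j) ≠ 0) :
    Adapted (b i 0) (varGroup hb i) (exponents J) := by
  refine adapted_exponents ((mem_varGroup hb).mpr ⟨0, rfl⟩) (fun y hy hy0 => ?_) fun a ha ha0 => ?_
  · obtain ⟨j, rfl⟩ := (mem_varGroup hb).mp hy
    exact h₁ j fun hj => hy0 (congrArg (b i) hj)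
  · obtain ⟨j, hj, haj⟩ := h₂ a ha ha0
    exact ⟨b i j, (mem_varGroup hb).mpr ⟨j, rfl⟩, (hb.comp sigma_mk_injective).ne hj, haj⟩

end VarGroups

theorem le_depth_of_adapted {σ k : Type*} [Finite σ] [Field k] {ι : Type*} [Finite ι] {x : ι → σ}
    {B : ι → Finset σ} (hB : Pairwise fun i j => Disjoint (B i) (B j))
    {I : Ideal (MvPolynomial σ k)} (hI : I ≠ ⊤) {ord : MonomialOrder σ}
    (h : ∀ i, Adapted (x i) (B i) (exponents (ini ord I))) :
    (Nat.card ι : ℕ∞) ≤ depth (MvPolynomial σ k) (MvPolynomial σ k ⧸ I) := by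
  have := Fintype.ofFinite σ
  have := Fintype.ofFinite ι
  have hfamily : AdaptedFamily Finset.univ Finset.univ x B (exponents (ini ord I)) :=
    { isUpperSet := isUpperSet_exponents _
      varDegreeLE_zero := fun y hy => absurd (Finset.mem_univ y) hy
      subset := fun i _ => Finset.subset_univ _
      pairwiseDisjoint := fun i _ j _ hij => hB hij
      adapted := fun i _ => h i }
  have hcard : Nat.card ι ≤ Nat.card σ := by
    simpa only [Finset.card_univ, ← Nat.card_eq_fintype_card] using hfamily.card_le_card
  have hlinear := hfamily.hasLinearQuotients (s := Nat.card σ - Nat.card ι)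
    (mt zero_mem_exponents_iff.mp (ini_ne_top hI)) <| by
      simp only [Finset.card_univ, ← Nat.card_eq_fintype_card, Nat.sub_add_cancel hcard, le_refl]
  exact le_depth_of_hasLinearQuotients (Nat.sub_add_cancel hcard).le hlinear

end InitReg

theorem theorem3p10_general {k : Type*} [Field k] {σ : Type*} [Finite σ]
    (I : Ideal (MvPolynomial σ k)) (hI : I ≠ ⊤)
    (ord₁ : MonomialOrder σ)
    (q : ℕ) (t : Fin q → ℕ) (b : (i : Fin q) → Fin (t i + 1) → σ)
    (hb : Function.Injective (fun p : (i : Fin q) × Fin (t i + 1) => b p.1 p.2))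
    (h₁ : ∀ (i : Fin q) (j : Fin (t i + 1)), j ≠ 0 →
      InitReg.varDegree (b i j) (InitReg.ini ord₁ I) ≤ 1)
    (h₂ : ∀ i : Fin q, ∀ a ∈ InitReg.minGens (InitReg.ini ord₁ I), a (b i 0) ≠ 0 →
      ∃ j : Fin (t i + 1), j ≠ 0 ∧ a (b i j) ≠ 0) :
    (∀ ord : Fin q → MonomialOrder σ, (∀ h : 0 < q, ord ⟨0, h⟩ = ord₁) →
      InitReg.IsInitiallyRegular ord
        (fun i => ∑ j : Fin (t i + 1), (MvPolynomial.X (b i j) : MvPolynomial σ k)) I) ∧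
    (q : ℕ∞) ≤ InitReg.depth (MvPolynomial σ k) (MvPolynomial σ k ⧸ I) := by
  have hdisjoint := InitReg.pairwise_disjoint_varGroup hb
  have hadapted := fun i => InitReg.adapted_varGroup hb i (h₁ i) (h₂ i)
  constructor
  · intro ord hord
    simp only [← InitReg.sum_varGroup hb]
    exact InitReg.isInitiallyRegular_of_adapted hdisjoint hI ord fun hq i =>
      (hord hq).symm ▸ hadapted i
  · simpa only [Nat.card_fin] using InitReg.le_depth_of_adapted hdisjoint hI hadapted

theorem theorem3p10 {k : Type*} [Field k] {n : ℕ}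
    (I : Ideal (MvPolynomial (Fin n) k)) (hI : I ≠ ⊤)
    (ord₁ : MonomialOrder (Fin n))
    (q : ℕ) (t : Fin q → ℕ) (b : (i : Fin q) → Fin (t i + 1) → Fin n)
    (hb : Function.Injective (fun p : (i : Fin q) × Fin (t i + 1) => b p.1 p.2))
    (h₁ : ∀ (i : Fin q) (j : Fin (t i + 1)), j ≠ 0 →
      InitReg.varDegree (b i j) (InitReg.ini ord₁ I) ≤ 1)
    (h₂ : ∀ i : Fin q, ∀ a ∈ InitReg.minGens (InitReg.ini ord₁ I), a (b i 0) ≠ 0 →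
      ∃ j : Fin (t i + 1), j ≠ 0 ∧ a (b i j) ≠ 0) :
    (∀ ord : Fin q → MonomialOrder (Fin n),
      (∀ h : 0 < q, ord ⟨0, h⟩ = ord₁) →
      (∀ (i : ℕ) (h : i + 1 < q) (j : Fin (t ⟨i, Nat.lt_of_succ_lt h⟩ + 1)), j ≠ 0 →
        Finsupp.single (b ⟨i, Nat.lt_of_succ_lt h⟩ j) 1 ≺[ord ⟨i + 1, h⟩]
          Finsupp.single (b ⟨i, Nat.lt_of_succ_lt h⟩ 0) 1) →
      InitReg.IsInitiallyRegular ord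
        (fun i => ∑ j : Fin (t i + 1), (MvPolynomial.X (b i j) : MvPolynomial (Fin n) k)) I) ∧
    (q : ℕ∞) ≤ InitReg.depth (MvPolynomial (Fin n) k) (MvPolynomial (Fin n) k ⧸ I) := by
  exact (theorem3p10_general I hI ord₁ q t b hb h₁ h₂).imp_left fun h ord hord _ => h ord hord
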